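/- Let $\mathcal H_S$ be a finite-dimensional and $\mathcal H_R$ a separable complex Hilbert space, $\mathcal H=\mathcal H_S\otimes\mathcal H_R$, and $\mathcal T(\cdot)$ the Banach space of trace class operators with the trace norm. Let $H_S,W$ be self-adjoint on $\mathcal H_S$, let $e^{-itH_R}$ be a strongly continuous unitary group on $\mathcal H_R$ with self-adjoint generator $H_R$, let $V$ be bounded and self-adjoint on $\mathcal H_R$, and let $\Omega_R$ be a unit vector with $H_R\Omega_R=0$; put $\omega_R=|\Omega_R\rangle\langle\Omega_R|$ and assume $\operatorname{tr}(V\omega_R)=0$. On $\mathcal T(\mathcal H)$ let $P\rho=\operatorname{tr}_R(\rho)\otimes\omega_R$, $Q=1-P$, $\mathcal L_{SR}\rho=[W\otimes V,\rho]$, $e^{-it\mathcal L_0}\rho=e^{-itH_0}\rho e^{itH_0}$ with $H_0=H_S\otimes1+1\otimes H_R$, and $\mathcal L_{SR}(s)=e^{is\mathcal L_0}\mathcal L_{SR}e^{-is\mathcal L_0}$. With $\Delta^{m}(t)=\{0\le z_1\le\dots\le z_m\le t\}$ let $$K_n(t)=\int_{\Delta^{n+1}(t)}P\mathcal L_{SR}(z_{n+1})Q\mathcal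 L_{SR}(z_n)Q\cdots Q\mathcal L_{SR}(z_1)Q\mathcal L_{SR}P\,dz .$$ Put $V(t)=e^{itH_R}Ve^{-itH_R}$ and assume that $\varphi(t)=\operatorname{tr}(V(t)V\omega_R)$ is in $L^1(\mathbb R)$. For $A\subset\{0,\dots,n+1\}$ and $z\in\Delta^{n+1}(t)$, $z_0:=0$, let $$\mathcal G_n(A,z)=\sum_d(-1)^{|d|+1}\prod_{s=1}^{|d|}\operatorname{tr}\Big(\prod_{k\in d_s^A}V(z_k)\,\omega_R\Big),$$ where $d=(d_1,\dots,d_{|d|})$ runs over the partitions of the sequence $(0,\dots,n+1)$ into contiguous subsequences of length at least $2$, and $d_s^A$ lists first the elements of $d_s$ in $A$ in increasing order, then those not in $A$ in decreasing order. Call a pair $(f,C)$ admissible if $f:\mathbb R\to[0,\infty)$, $\int f(s)(1+|s|)^{\epsilon}ds<\infty$ for some $0<\epsilon<1$, $C>0$, and for all $n\ge1$, $A\subset\{0,\dots,n+1\}$, $t$ and $z\in\Delta^{n+1}(t)$ $$|\mathcal G_n(A,z)|\le\frac{C^{n+2}}{[n/2]!}\sum_{p}\prod_{l=0}^{[(n+1)/2]}f(z_{p(l)}-z_{p(l+1)}),$$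 where $p$ runs over the permutations of $\{0,\dots,n+1\}$ with $|p(1)-p(0)|\ge2$. Put $$c_n(f,C)=\frac{(2C\|W\|)^{n+2}}{[n/2]!}\,\|f\|_1^{[(n+1)/2]+1}.$$ Let $(f,C)$ be any admissible pair. Then for all $n\ge1$ and $t>0$ the integral defining $K_n(t)$ converges absolutely in operator norm and $$\|K_n(t)\|\le(n+2)\,c_n(f,C)\,t^{[n/2]}.$$ Moreover there is a constant $C'\in[C,2C]$ such that $(f,C')$ is admissible and, for all $n\ge1$ and $t>0$, $$\|K_n(t)\|\le c_n(f,C')\,t^{[n/2]},$$ and the power series $\sum_{n\ge1}c_n(f,C')s^n$ has infinite radius of convergence. -/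

import Mathlib

open MeasureTheory Filter Topology InnerProductSpace
open scoped TensorProduct

noncomputable section

namespace WeakCoupling

/-! ## Trace class operators

`A` is trace class when `A = ∑ₖ |xₖ⟩⟨yₖ|` with `∑ₖ ‖xₖ‖ ‖yₖ‖ < ∞`; the trace norm is the infimum of
`∑ₖ ‖xₖ‖ ‖yₖ‖` over all such representations.  On a Hilbert space this is the same class and
the same norm as those given by `tr |A|`. -/

section TraceClass

variable {H : Type*} [NormedAddCommGroup H] [InnerProductSpace ℂ H]

/-- `∑ₖ |xₖ⟩⟨yₖ|` is an absolutely summable expansion of `A`. -/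
structure IsNuclearRep {ι : Type*} (A : H →L[ℂ] H) (x y : ι → H) : Prop where
  summable : Summable fun k => ‖x k‖ * ‖y k‖
  hasSum : HasSum (fun k => rankOne ℂ (x k) (y k)) A

/-- `A` is a trace class operator. -/
def IsTraceClass (A : H →L[ℂ] H) : Prop :=
  ∃ x y : ℕ → H, IsNuclearRep A x y

/-- The trace norm of a trace class operator. -/
def traceNorm (A : H →L[ℂ] H) : ℝ :=
  sInf {r | ∃ x y : ℕ → H, IsNuclearRep A x y ∧ r = ∑' k, ‖x k‖ * ‖y k‖}

lemma IsNuclearRep.exists_nat {ι : Type*} [Countable ι] {A : H →L[ℂ] H} {x y : ι → H}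
    (h : IsNuclearRep A x y) :
    ∃ x' y' : ℕ → H, IsNuclearRep A x' y' ∧
      ∑' k, ‖x' k‖ * ‖y' k‖ = ∑' k, ‖x k‖ * ‖y k‖ := by
  obtain ⟨e, he⟩ := exists_injective_nat ι
  have hx (i : ι) : Function.extend e x 0 (e i) = x i := he.extend_apply _ _ _
  have hy (i : ι) : Function.extend e y 0 (e i) = y i := he.extend_apply _ _ _
  have hx0 (k : ℕ) (hk : k ∉ Set.range e) : Function.extend e x 0 k = 0 := by
    rw [Function.extend_apply' _ _ _ hk]; rfl
  have key : HasSum (fun k => ‖Function.extend e x 0 k‖ * ‖Function.extend e y 0 k‖)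
      (∑' k, ‖x k‖ * ‖y k‖) := by
    rw [← he.hasSum_iff]
    · simpa [Function.comp_def, hx, hy] using h.summable.hasSum
    · intro k hk; simp [hx0 k hk]
  refine ⟨Function.extend e x 0, Function.extend e y 0, ⟨key.summable, ?_⟩, key.tsum_eq⟩
  rw [← he.hasSum_iff]
  · simpa [Function.comp_def, hx, hy] using h.hasSum
  · intro k hk; simp [hx0 k hk]

lemma IsNuclearRep.isTraceClass {ι : Type*} [Countable ι] {A : H →L[ℂ] H} {x y : ι → H}
    (h : IsNuclearRep A x y) : IsTraceClass A := by
  obtain ⟨x', y', h', -⟩ := h.exists_nat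
  exact ⟨x', y', h'⟩

lemma traceNorm_bddBelow (A : H →L[ℂ] H) :
    BddBelow {r | ∃ x y : ℕ → H, IsNuclearRep A x y ∧ r = ∑' k, ‖x k‖ * ‖y k‖} := by
  refine ⟨0, ?_⟩
  rintro r ⟨x, y, -, rfl⟩
  exact tsum_nonneg fun k => by positivity

lemma traceNorm_nonneg (A : H →L[ℂ] H) : 0 ≤ traceNorm A := by
  apply Real.sInf_nonneg
  rintro r ⟨x, y, -, rfl⟩
  exact tsum_nonneg fun k => by positivity

lemma IsNuclearRep.traceNorm_le {ι : Type*} [Countable ι] {A : H →L[ℂ] H} {x y : ι → H}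
    (h : IsNuclearRep A x y) : traceNorm A ≤ ∑' k, ‖x k‖ * ‖y k‖ := by
  obtain ⟨x', y', h', e⟩ := h.exists_nat
  rw [← e]
  exact csInf_le (traceNorm_bddBelow A) ⟨x', y', h', rfl⟩

lemma IsNuclearRep.norm_le {ι : Type*} {A : H →L[ℂ] H} {x y : ι → H}
    (h : IsNuclearRep A x y) : ‖A‖ ≤ ∑' k, ‖x k‖ * ‖y k‖ := by
  rw [← h.hasSum.tsum_eq]
  refine (norm_tsum_le_tsum_norm ?_).trans_eq ?_
  · simpa using h.summable
  · simp

/-- Almost optimal expansions. -/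
lemma IsTraceClass.exists_rep {A : H →L[ℂ] H} (h : IsTraceClass A) {ε : ℝ} (hε : 0 < ε) :
    ∃ x y : ℕ → H, IsNuclearRep A x y ∧ ∑' k, ‖x k‖ * ‖y k‖ < traceNorm A + ε := by
  obtain ⟨x, y, hxy⟩ := h
  obtain ⟨r, ⟨x, y, h, rfl⟩, hr⟩ := exists_lt_of_csInf_lt
    (s := {r | ∃ x y : ℕ → H, IsNuclearRep A x y ∧ r = ∑' k, ‖x k‖ * ‖y k‖})
    ⟨_, x, y, hxy, rfl⟩ (lt_add_of_pos_right (traceNorm A) hε)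
  exact ⟨x, y, h, hr⟩

lemma IsTraceClass.norm_le {A : H →L[ℂ] H} (h : IsTraceClass A) : ‖A‖ ≤ traceNorm A := by
  obtain ⟨x, y, hxy⟩ := h
  refine le_csInf ⟨_, x, y, hxy, rfl⟩ ?_
  rintro r ⟨x, y, h, rfl⟩
  exact h.norm_le

lemma isNuclearRep_zero : IsNuclearRep (0 : H →L[ℂ] H) (fun _ : Empty => (0 : H)) fun _ => 0 :=
  ⟨summable_empty, by simp⟩

lemma IsNuclearRep.add {ι κ : Type*} {A B : H →L[ℂ] H} {x y : ι → H} {x' y' : κ → H}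
    (h : IsNuclearRep A x y) (h' : IsNuclearRep B x' y') :
    IsNuclearRep (A + B) (Sum.elim x x') (Sum.elim y y') := by
  refine ⟨(HasSum.sum (f := fun k => ‖Sum.elim x x' k‖ * ‖Sum.elim y y' k‖)
    h.summable.hasSum h'.summable.hasSum).summable, ?_⟩
  exact HasSum.sum (f := fun k => rankOne ℂ (Sum.elim x x' k) (Sum.elim y y' k))
    h.hasSum h'.hasSum

lemma IsNuclearRep.tsum_add {ι κ : Type*} {A B : H →L[ℂ] H} {x y : ι → H} {x' y' : κ → H}
    (h : IsNuclearRep A x y) (h' : IsNuclearRep B x' y') :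
    ∑' k, ‖Sum.elim x x' k‖ * ‖Sum.elim y y' k‖ =
      ∑' k, ‖x k‖ * ‖y k‖ + ∑' k, ‖x' k‖ * ‖y' k‖ :=
  (HasSum.sum (f := fun k => ‖Sum.elim x x' k‖ * ‖Sum.elim y y' k‖)
    h.summable.hasSum h'.summable.hasSum).tsum_eq

lemma IsNuclearRep.sandwich {ι : Type*} {K : Type*} [NormedAddCommGroup K] [InnerProductSpace ℂ K]
    [CompleteSpace H] [CompleteSpace K] {ρ : H →L[ℂ] H} {x y : ι → H} (h : IsNuclearRep ρ x y)
    (A : H →L[ℂ] K) (B : K →L[ℂ] H) :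
    IsNuclearRep (A ∘L ρ ∘L B) (fun k => A (x k)) (fun k => B.adjoint (y k)) := by
  constructor
  · refine (h.summable.mul_left (‖A‖ * ‖B.adjoint‖)).of_nonneg_of_le
      (fun k => by positivity) fun k => ?_
    calc ‖A (x k)‖ * ‖B.adjoint (y k)‖ ≤ (‖A‖ * ‖x k‖) * (‖B.adjoint‖ * ‖y k‖) := by
          gcongr <;> exact ContinuousLinearMap.le_opNorm _ _
      _ = _ := by ring
  · have := ((ContinuousLinearMap.compL ℂ K H K A) ∘L
      ((ContinuousLinearMap.compL ℂ K H H).flip B)).hasSum h.hasSum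
    simpa [Function.comp_def, rankOne_comp, comp_rankOne] using this

lemma IsNuclearRep.smul {ι : Type*} {A : H →L[ℂ] H} {x y : ι → H} (h : IsNuclearRep A x y)
    (c : ℂ) : IsNuclearRep (c • A) (fun k => c • x k) y := by
  constructor
  · simpa [norm_smul, mul_assoc] using h.summable.mul_left ‖c‖
  · simpa using h.hasSum.const_smul c

lemma traceNorm_add_le {A B : H →L[ℂ] H} (hA : IsTraceClass A) (hB : IsTraceClass B) :
    traceNorm (A + B) ≤ traceNorm A + traceNorm B := by
  refine le_of_forall_pos_le_add fun ε hε => ?_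
  obtain ⟨x, y, h, h1⟩ := hA.exists_rep (half_pos hε)
  obtain ⟨x', y', h', h2⟩ := hB.exists_rep (half_pos hε)
  have := (h.add h').traceNorm_le
  rw [h.tsum_add h'] at this
  linarith

lemma traceNorm_smul_le {A : H →L[ℂ] H} (hA : IsTraceClass A) (c : ℂ) :
    traceNorm (c • A) ≤ ‖c‖ * traceNorm A := by
  refine le_of_forall_pos_le_add fun ε hε => ?_
  obtain ⟨x, y, h, h1⟩ := hA.exists_rep (ε := ε / (‖c‖ + 1)) (by positivity)
  have h2 := (h.smul c).traceNorm_le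
  have h3 : ∑' k, ‖c • x k‖ * ‖y k‖ = ‖c‖ * ∑' k, ‖x k‖ * ‖y k‖ := by
    simp [norm_smul, mul_assoc, tsum_mul_left]
  rw [h3] at h2
  have h4 : ‖c‖ * (ε / (‖c‖ + 1)) ≤ ε := by
    rw [mul_div_assoc', div_le_iff₀ (by positivity)]
    nlinarith [norm_nonneg c]
  calc _ ≤ _ := h2
    _ ≤ ‖c‖ * (traceNorm A + ε / (‖c‖ + 1)) := by gcongr
    _ ≤ _ := by rw [mul_add]; gcongr

lemma traceNorm_zero : traceNorm (0 : H →L[ℂ] H) = 0 := by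
  refine le_antisymm ?_ (traceNorm_nonneg _)
  simpa using (isNuclearRep_zero (H := H)).traceNorm_le

variable (H) in
/-- The trace class operators as a linear subspace of the bounded operators. -/
def traceClassSubmodule : Submodule ℂ (H →L[ℂ] H) where
  carrier := {A | IsTraceClass A}
  zero_mem' := isNuclearRep_zero.isTraceClass
  add_mem' := by
    rintro A B ⟨x, y, h⟩ ⟨x', y', h'⟩
    exact (h.add h').isTraceClass
  smul_mem' := by
    rintro c A ⟨x, y, h⟩
    exact (h.smul c).isTraceClass

variable (H) in
/-- The Banach space `𝒯(H)` of trace class operators on `H`, with the trace norm. -/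
def TraceClass : Type _ := traceClassSubmodule H

namespace TraceClass

instance : AddCommGroup (TraceClass H) := inferInstanceAs (AddCommGroup (traceClassSubmodule H))

instance : Module ℂ (TraceClass H) := inferInstanceAs (Module ℂ (traceClassSubmodule H))

/-- The underlying bounded operator, as a linear map. -/
def toOp : TraceClass H →ₗ[ℂ] (H →L[ℂ] H) := (traceClassSubmodule H).subtype

/-- A bounded operator that is trace class, as an element of `𝒯(H)`. -/
def mk (A : H →L[ℂ] H) (hA : IsTraceClass A) : TraceClass H := ⟨A, hA⟩

@[simp] lemma toOp_mk (A : H →L[ℂ] H) (hA : IsTraceClass A) : (mk A hA).toOp = A := rfl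

lemma isTraceClass (ρ : TraceClass H) : IsTraceClass ρ.toOp := ρ.2

lemma toOp_injective : Function.Injective (toOp : TraceClass H →ₗ[ℂ] (H →L[ℂ] H)) :=
  Subtype.val_injective

@[ext] lemma ext {ρ σ : TraceClass H} (h : ρ.toOp = σ.toOp) : ρ = σ := toOp_injective h

instance : Norm (TraceClass H) := ⟨fun ρ => traceNorm ρ.toOp⟩

lemma norm_def (ρ : TraceClass H) : ‖ρ‖ = traceNorm ρ.toOp := rfl

lemma core : NormedSpace.Core ℂ (TraceClass H) where
  norm_nonneg ρ := traceNorm_nonneg _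
  norm_smul c ρ := by
    simp only [norm_def, map_smul]
    refine le_antisymm (traceNorm_smul_le ρ.isTraceClass c) ?_
    rcases eq_or_ne c 0 with rfl | hc
    · simp [traceNorm_zero]
    · have h := traceNorm_smul_le (c • ρ).isTraceClass c⁻¹
      rw [map_smul, smul_smul, inv_mul_cancel₀ hc, one_smul, norm_inv] at h
      rwa [inv_mul_eq_div, le_div_iff₀ (norm_pos_iff.mpr hc), mul_comm] at h
  norm_triangle ρ σ := by
    simp only [norm_def, map_add]
    exact traceNorm_add_le ρ.isTraceClass σ.isTraceClass
  norm_eq_zero_iff ρ := by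
    constructor
    · intro h
      have h1 := ρ.isTraceClass.norm_le
      rw [← norm_def, h] at h1
      exact ext (by simpa using h1)
    · rintro rfl
      simp [norm_def, traceNorm_zero]

instance : NormedAddCommGroup (TraceClass H) := NormedAddCommGroup.ofCore core

instance : NormedSpace ℂ (TraceClass H) := NormedSpace.ofCore core

lemma norm_toOp_le (ρ : TraceClass H) : ‖ρ.toOp‖ ≤ ‖ρ‖ := ρ.isTraceClass.norm_le

lemma exists_rep (ρ : TraceClass H) {ε : ℝ} (hε : 0 < ε) :
    ∃ x y : ℕ → H, IsNuclearRep ρ.toOp x y ∧ ∑' k, ‖x k‖ * ‖y k‖ < ‖ρ‖ + ε :=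
  ρ.isTraceClass.exists_rep hε

lemma exists_hasSum_rep [CompleteSpace H] {u : ℕ → (H →L[ℂ] H)} {x y : ℕ → ℕ → H}
    (h : ∀ k, IsNuclearRep (u k) (x k) (y k))
    (hs : Summable fun k => ∑' j, ‖x k j‖ * ‖y k j‖) :
    ∃ A, HasSum u A ∧ IsTraceClass A ∧ traceNorm A ≤ ∑' k, ∑' j, ‖x k j‖ * ‖y k j‖ := by
  have hprod : Summable fun p : ℕ × ℕ => ‖x p.1 p.2‖ * ‖y p.1 p.2‖ :=
    (summable_prod_of_nonneg fun p => by positivity).2 ⟨fun k => (h k).summable, hs⟩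
  have hop : Summable fun p : ℕ × ℕ => rankOne ℂ (x p.1 p.2) (y p.1 p.2) :=
    Summable.of_norm (by simpa using hprod)
  have hrep : IsNuclearRep (∑' p : ℕ × ℕ, rankOne ℂ (x p.1 p.2) (y p.1 p.2))
      (fun p : ℕ × ℕ => x p.1 p.2) (fun p : ℕ × ℕ => y p.1 p.2) := ⟨hprod, hop.hasSum⟩
  refine ⟨_, hop.hasSum.prod_fiberwise fun k => (h k).hasSum, hrep.isTraceClass, ?_⟩
  refine hrep.traceNorm_le.trans_eq ?_
  exact hprod.tsum_prod' fun k => (h k).summable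

instance [CompleteSpace H] : CompleteSpace (TraceClass H) := by
  refine NormedAddCommGroup.completeSpace_of_summable_imp_tendsto fun u hu => ?_
  choose x y hxy hlt using fun k => (u k).exists_rep (ε := (1 / 2 : ℝ) ^ k) (by positivity)
  have hs : Summable fun k => ∑' j, ‖x k j‖ * ‖y k j‖ :=
    (hu.add summable_geometric_two).of_nonneg_of_le
      (fun k => tsum_nonneg fun j => by positivity) fun k => (hlt k).le
  obtain ⟨A, hA, hAt, -⟩ := exists_hasSum_rep hxy hs
  refine ⟨mk A hAt, ?_⟩
  rw [tendsto_iff_norm_sub_tendsto_zero]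
  refine squeeze_zero (fun _ => norm_nonneg _) (fun N => ?_)
    (tendsto_sum_nat_add fun k => ∑' j, ‖x k j‖ * ‖y k j‖)
  obtain ⟨B, hB, -, hBn⟩ := exists_hasSum_rep (fun k => hxy (k + N))
    ((summable_nat_add_iff N).2 hs)
  have hBA : B = A - ∑ i ∈ Finset.range N, (u i).toOp :=
    hB.unique ((hasSum_nat_add_iff' N).2 hA)
  rw [norm_sub_rev, norm_def, map_sub, map_sum, toOp_mk, ← hBA]
  exact hBn

/-- The map `ρ ↦ A ρ B` on trace class operators, for bounded `A : H → K` and `B : K → H`. -/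
def sandwich {K : Type*} [NormedAddCommGroup K] [InnerProductSpace ℂ K]
    [CompleteSpace H] [CompleteSpace K] (A : H →L[ℂ] K) (B : K →L[ℂ] H) :
    TraceClass H →L[ℂ] TraceClass K :=
  LinearMap.mkContinuous
    { toFun := fun ρ => mk (A ∘L ρ.toOp ∘L B) (by
        obtain ⟨x, y, h⟩ := ρ.isTraceClass
        exact (h.sandwich A B).isTraceClass)
      map_add' := fun ρ σ => by ext; simp
      map_smul' := fun c ρ => by ext; simp }
    (‖A‖ * ‖B‖) fun ρ => by
      refine le_of_forall_pos_le_add fun ε hε => ?_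
      obtain ⟨x, y, h, hlt⟩ := ρ.exists_rep (ε := ε / (‖A‖ * ‖B‖ + 1)) (by positivity)
      have h1 : traceNorm (A ∘L ρ.toOp ∘L B) ≤ ‖A‖ * ‖B‖ * ∑' k, ‖x k‖ * ‖y k‖ := by
        refine (h.sandwich A B).traceNorm_le.trans ?_
        rw [← tsum_mul_left]
        refine (h.sandwich A B).summable.tsum_le_tsum (fun k => ?_) (h.summable.mul_left _)
        calc ‖A (x k)‖ * ‖B.adjoint (y k)‖ ≤ (‖A‖ * ‖x k‖) * (‖B.adjoint‖ * ‖y k‖) := by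
              gcongr <;> exact ContinuousLinearMap.le_opNorm _ _
          _ = _ := by rw [LinearIsometryEquiv.norm_map]; ring
      have h2 : ‖A‖ * ‖B‖ * (ε / (‖A‖ * ‖B‖ + 1)) ≤ ε := by
        have : 0 ≤ ‖A‖ * ‖B‖ := by positivity
        rw [mul_div_assoc', div_le_iff₀ (by positivity)]
        nlinarith
      change traceNorm (A ∘L ρ.toOp ∘L B) ≤ _
      calc _ ≤ _ := h1
        _ ≤ ‖A‖ * ‖B‖ * (‖ρ‖ + ε / (‖A‖ * ‖B‖ + 1)) := by gcongr
        _ ≤ _ := by rw [mul_add]; gcongr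

@[simp] lemma toOp_sandwich {K : Type*} [NormedAddCommGroup K] [InnerProductSpace ℂ K]
    [CompleteSpace H] [CompleteSpace K] (A : H →L[ℂ] K) (B : K →L[ℂ] H) (ρ : TraceClass H) :
    (sandwich A B ρ).toOp = A ∘L ρ.toOp ∘L B := rfl

end TraceClass

variable (H) in
/-- An orthonormal basis of `H`. -/
def basis [CompleteSpace H] : HilbertBasis (exists_hilbertBasis ℂ H).choose ℂ H :=
  (exists_hilbertBasis ℂ H).choose_spec.choose

/-- The trace `∑ᵢ ⟨eᵢ, A eᵢ⟩` of an operator, in an orthonormal basis of `H` (for `A` trace class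
the value does not depend on the basis). -/
def trace [CompleteSpace H] (A : H →L[ℂ] H) : ℂ :=
  ∑' i, inner ℂ (basis H i) (A (basis H i))

lemma trace_rankOne [CompleteSpace H] (x y : H) : trace (rankOne ℂ x y) = inner ℂ y x := by
  simp only [trace, rankOne_apply, inner_smul_right]
  exact HilbertBasis.tsum_inner_mul_inner _ y x

end TraceClass

/-! ## Composite systems -/

section Composite

variable {HS HR : Type*}
  [NormedAddCommGroup HS] [InnerProductSpace ℂ HS]
  [NormedAddCommGroup HR] [InnerProductSpace ℂ HR]

/-- With a finite-dimensional first factor the algebraic tensor product is complete, that is, it is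
the Hilbert space tensor product. -/
instance [FiniteDimensional ℂ HS] [CompleteSpace HR] : CompleteSpace (HS ⊗[ℂ] HR) := by
  let e := stdOrthonormalBasis ℂ HS
  let T (i) : HS ⊗[ℂ] HR →L[ℂ] HR :=
    (TensorProduct.lidIsometry ℂ HR).toContinuousLinearEquiv.toContinuousLinearMap ∘L
      (innerSL ℂ (e i)).rTensor HR
  have hT (x : HS ⊗[ℂ] HR) : x = ∑ i, e i ⊗ₜ[ℂ] T i x := by
    induction x with
    | zero => simp
    | tmul a b =>
      have hT' (i) : T i (a ⊗ₜ[ℂ] b) = inner ℂ (e i) a • b := by simp [T]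
      simp_rw [hT', TensorProduct.tmul_smul, TensorProduct.smul_tmul', ← TensorProduct.sum_tmul]
      rw [e.sum_repr' a]
    | add x y hx hy =>
      simp only [map_add, TensorProduct.tmul_add, Finset.sum_add_distrib]
      rw [← hx, ← hy]
  refine Metric.complete_of_cauchySeq_tendsto fun u hu => ?_
  have hc (i) : ∃ r, Tendsto (fun n => T i (u n)) atTop (𝓝 r) :=
    cauchySeq_tendsto_of_complete ((T i).uniformContinuous.comp_cauchySeq hu)
  choose r hr using hc
  refine ⟨∑ i, e i ⊗ₜ[ℂ] r i, ?_⟩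
  have : u = fun n => ∑ i, e i ⊗ₜ[ℂ] T i (u n) := funext fun n => hT _
  rw [this]
  refine tendsto_finsetSum _ fun i _ => ?_
  exact ((TensorProduct.mkL ℂ HS HR (e i)).continuous.tendsto _).comp (hr i)

/-- The operator `a ↦ a ⊗ r`. -/
def tensorRight (r : HR) : HS →L[ℂ] HS ⊗[ℂ] HR := (TensorProduct.mkL ℂ HS HR).flip r

@[simp] lemma tensorRight_apply (r : HR) (a : HS) : tensorRight r a = a ⊗ₜ[ℂ] r := rfl

variable [FiniteDimensional ℂ HS] [CompleteSpace HS] [CompleteSpace HR]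

lemma sum_norm_sq_adjoint_tensorRight_le {ι : Type*} {b : ι → HR} (hb : Orthonormal ℂ b)
    (x : HS ⊗[ℂ] HR) (s : Finset ι) :
    ∑ i ∈ s, ‖(tensorRight (HS := HS) (b i)).adjoint x‖ ^ 2 ≤ ‖x‖ ^ 2 := by
  have e := stdOrthonormalBasis ℂ HS
  have h := ((e.orthonormal).tmul hb).sum_inner_products_le x (s := Finset.univ ×ˢ s)
  rw [Finset.sum_product_right] at h
  refine le_trans (le_of_eq (Finset.sum_congr rfl fun i _ => ?_)) h
  rw [← e.sum_sq_norm_inner_right]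
  refine Finset.sum_congr rfl fun j _ => ?_
  rw [ContinuousLinearMap.adjoint_inner_right, tensorRight_apply]

lemma sum_norm_mul_norm_adjoint_tensorRight_le {ι : Type*} {b : ι → HR} (hb : Orthonormal ℂ b)
    (x y : HS ⊗[ℂ] HR) (s : Finset ι) :
    ∑ i ∈ s, ‖(tensorRight (HS := HS) (b i)).adjoint x‖ *
      ‖(tensorRight (HS := HS) (b i)).adjoint y‖ ≤ ‖x‖ * ‖y‖ := by
  refine (Real.sum_mul_le_sqrt_mul_sqrt _ _ _).trans ?_
  gcongr
  · exact Real.sqrt_le_left (norm_nonneg _) |>.2 (sum_norm_sq_adjoint_tensorRight_le hb x s)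
  · exact Real.sqrt_le_left (norm_nonneg _) |>.2 (sum_norm_sq_adjoint_tensorRight_le hb y s)

lemma sum_norm_sandwich_le {ι : Type*} {b : ι → HR} (hb : Orthonormal ℂ b)
    (ρ : TraceClass (HS ⊗[ℂ] HR)) (s : Finset ι) :
    ∑ i ∈ s, ‖TraceClass.sandwich (tensorRight (HS := HS) (b i)).adjoint (tensorRight (b i)) ρ‖
      ≤ ‖ρ‖ := by
  refine le_of_forall_pos_le_add fun ε hε => ?_
  obtain ⟨x, y, h, hlt⟩ := ρ.exists_rep hε
  have h' (i : ι) :=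
    h.sandwich (tensorRight (HS := HS) (b i)).adjoint (tensorRight (HS := HS) (b i))
  calc _ ≤ ∑ i ∈ s, ∑' k, ‖(tensorRight (HS := HS) (b i)).adjoint (x k)‖ *
          ‖(tensorRight (HS := HS) (b i)).adjoint (y k)‖ :=
        Finset.sum_le_sum fun i _ => (h' i).traceNorm_le
    _ = ∑' k, ∑ i ∈ s, ‖(tensorRight (HS := HS) (b i)).adjoint (x k)‖ *
          ‖(tensorRight (HS := HS) (b i)).adjoint (y k)‖ :=
        (Summable.tsum_finsetSum fun i _ => (h' i).summable).symm
    _ ≤ ∑' k, ‖x k‖ * ‖y k‖ :=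
        (summable_sum fun i _ => (h' i).summable).tsum_le_tsum
          (fun k => sum_norm_mul_norm_adjoint_tensorRight_le hb (x k) (y k) s) h.summable
    _ ≤ _ := hlt.le

lemma summable_sandwich {ι : Type*} {b : ι → HR} (hb : Orthonormal ℂ b)
    (ρ : TraceClass (HS ⊗[ℂ] HR)) :
    Summable fun i =>
      TraceClass.sandwich (tensorRight (HS := HS) (b i)).adjoint (tensorRight (b i)) ρ :=
  Summable.of_norm (summable_of_sum_le (fun _ => norm_nonneg _) (sum_norm_sandwich_le hb ρ))

variable (HS HR) in
/-- The partial trace `tr_R ρ = ∑ᵢ (1 ⊗ ⟨eᵢ|) ρ (1 ⊗ |eᵢ⟩)` over the second factor, where `(eᵢ)` is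
an orthonormal basis of `H_R`; the series converges in trace norm. -/
def partialTrace : TraceClass (HS ⊗[ℂ] HR) →L[ℂ] TraceClass HS :=
  LinearMap.mkContinuous
    { toFun := fun ρ => ∑' i, TraceClass.sandwich
        (tensorRight (HS := HS) (basis HR i)).adjoint (tensorRight (basis HR i)) ρ
      map_add' := fun ρ σ => by
        simp only [map_add]
        exact (summable_sandwich (basis HR).orthonormal ρ).tsum_add
          (summable_sandwich (basis HR).orthonormal σ)
      map_smul' := fun c ρ => by
        simp only [map_smul, RingHom.id_apply]
        exact (summable_sandwich (basis HR).orthonormal ρ).tsum_const_smul c }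
    1 fun ρ => by
      rw [one_mul]
      have hs : Summable fun i => ‖TraceClass.sandwich
          (tensorRight (HS := HS) (basis HR i)).adjoint (tensorRight (basis HR i)) ρ‖ :=
        summable_of_sum_le (fun _ => norm_nonneg _)
          (sum_norm_sandwich_le (basis HR).orthonormal ρ)
      exact (norm_tsum_le_tsum_norm hs).trans
        (hs.tsum_le_of_sum_le (sum_norm_sandwich_le (basis HR).orthonormal ρ))

variable (HS) in
/-- The map `σ ↦ σ ⊗ |Ω⟩⟨Ω|` from `𝒯(H_S)` to `𝒯(H_S ⊗ H_R)`. -/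
def tensorState (Ω : HR) : TraceClass HS →L[ℂ] TraceClass (HS ⊗[ℂ] HR) :=
  TraceClass.sandwich (tensorRight Ω) (tensorRight Ω).adjoint

lemma toOp_tensorState (Ω : HR) (σ : TraceClass HS) :
    (tensorState HS Ω σ).toOp = TensorProduct.mapL σ.toOp (rankOne ℂ Ω Ω) := by
  have h (a : HS) (r : HR) : (tensorRight (HS := HS) Ω).adjoint (a ⊗ₜ[ℂ] r) = inner ℂ Ω r • a := by
    refine ext_inner_left ℂ fun c => ?_
    rw [ContinuousLinearMap.adjoint_inner_right, tensorRight_apply, TensorProduct.inner_tmul,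
      inner_smul_right, mul_comm]
  ext x
  induction x with
  | zero => simp
  | tmul a r =>
    simp [tensorState, h, TensorProduct.smul_tmul']
  | add x y hx hy => rw [map_add, map_add, hx, hy]

end Composite

/-! ## The model -/

/-- A strongly continuous one-parameter unitary group `t ↦ e^{-itH}`; by Stone's theorem these are
exactly the groups generated by the self-adjoint operators `H`. -/
structure UnitaryGroup (H : Type*) [NormedAddCommGroup H] [InnerProductSpace ℂ H]
    [CompleteSpace H] where
  /-- the operator `e^{-itH}` -/
  op : ℝ → H →L[ℂ] H
  mem_unitary : ∀ t, op t ∈ unitary (H →L[ℂ] H)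
  map_zero : op 0 = 1
  map_add : ∀ s t, op (s + t) = op s * op t
  continuous : ∀ x, Continuous fun t => op t x

/-- The self-adjoint generator `H` of `e^{-itH}`: `Hx = i (d/dt) e^{-itH} x` at `t = 0`, on the
domain of all `x` for which this derivative exists. -/
def UnitaryGroup.generator {H : Type*} [NormedAddCommGroup H] [InnerProductSpace ℂ H]
    [CompleteSpace H] (U : UnitaryGroup H) : H →ₗ.[ℂ] H where
  domain :=
    { carrier := {x | DifferentiableAt ℝ (fun t => U.op t x) 0}
      zero_mem' := by simp
      add_mem' := fun {x y} hx hy => by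
        simpa using DifferentiableAt.fun_add (f := fun t => U.op t x) (g := fun t => U.op t y) hx hy
      smul_mem' := fun c x hx => by
        simpa using DifferentiableAt.fun_const_smul (f := fun t => U.op t x) hx c }
  toFun :=
    { toFun := fun x => Complex.I • deriv (fun t => U.op t (x : H)) 0
      map_add' := fun x y => by
        have hx : DifferentiableAt ℝ (fun t => U.op t (x : H)) 0 := x.2
        have hy : DifferentiableAt ℝ (fun t => U.op t (y : H)) 0 := y.2
        simp only [Submodule.coe_add, _root_.map_add]
        rw [deriv_fun_add hx hy, smul_add]
      map_smul' := fun c x => by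
        have hx : DifferentiableAt ℝ (fun t => U.op t (x : H)) 0 := x.2
        simp only [Submodule.coe_smul, map_smul, RingHom.id_apply]
        rw [deriv_fun_const_smul c hx, smul_comm] }

/-- A finite-dimensional system coupled to a reservoir with an invariant reference vector. -/
structure Model (HS HR : Type*)
    [NormedAddCommGroup HS] [InnerProductSpace ℂ HS] [CompleteSpace HS]
    [NormedAddCommGroup HR] [InnerProductSpace ℂ HR] [CompleteSpace HR] where
  /-- the Hamiltonian `H_S` of the system -/
  hamS : HS →L[ℂ] HS
  /-- the system part of the coupling `W ⊗ V` -/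
  W : HS →L[ℂ] HS
  /-- the free evolution `e^{-itH_R}` of the reservoir -/
  U : UnitaryGroup HR
  /-- the reservoir part of the coupling `W ⊗ V` -/
  V : HR →L[ℂ] HR
  /-- the reference vector `Ω_R` of the reservoir -/
  Ω : HR
  hamS_selfAdjoint : IsSelfAdjoint hamS
  W_selfAdjoint : IsSelfAdjoint W
  V_selfAdjoint : IsSelfAdjoint V
  norm_Ω : ‖Ω‖ = 1
  Ω_invariant : ∃ h : Ω ∈ U.generator.domain, U.generator ⟨Ω, h⟩ = 0
  trace_V : trace (V * rankOne ℂ Ω Ω) = 0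

namespace Model

variable {HS HR : Type*}
  [NormedAddCommGroup HS] [InnerProductSpace ℂ HS] [CompleteSpace HS]
  [NormedAddCommGroup HR] [InnerProductSpace ℂ HR] [CompleteSpace HR]

/-- The reference state `ω_R`, the rank-one projection onto the span of `Ω_R`. -/
def ωR (M : Model HS HR) : HR →L[ℂ] HR := rankOne ℂ M.Ω M.Ω

/-- `V(t) = e^{itH_R} V e^{-itH_R}`. -/
def Vt (M : Model HS HR) (t : ℝ) : HR →L[ℂ] HR := M.U.op (-t) * M.V * M.U.op t

/-- The two-point correlation function `φ(t) = tr (V(t) V ω_R)`. -/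
def correlation (M : Model HS HR) (t : ℝ) : ℂ := trace (M.Vt t * M.V * M.ωR)

section Dyson

variable [FiniteDimensional ℂ HS]

/-- `P ρ = tr_R ρ ⊗ ω_R`. -/
def P (M : Model HS HR) : TraceClass (HS ⊗[ℂ] HR) →L[ℂ] TraceClass (HS ⊗[ℂ] HR) :=
  tensorState HS M.Ω ∘L partialTrace HS HR

/-- `Q = 1 - P`. -/
def Q (M : Model HS HR) : TraceClass (HS ⊗[ℂ] HR) →L[ℂ] TraceClass (HS ⊗[ℂ] HR) :=
  ContinuousLinearMap.id ℂ _ - M.P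

/-- `e^{-it(H_S ⊗ 1 + 1 ⊗ H_R)} = e^{-itH_S} ⊗ e^{-itH_R}`. -/
def freeOp (M : Model HS HR) (t : ℝ) : HS ⊗[ℂ] HR →L[ℂ] HS ⊗[ℂ] HR :=
  TensorProduct.mapL (NormedSpace.exp ((-(Complex.I * (t : ℂ))) • M.hamS)) (M.U.op t)

/-- The free evolution
`e^{-itℒ₀} ρ = e^{-it(H_S ⊗ 1 + 1 ⊗ H_R)} ρ e^{it(H_S ⊗ 1 + 1 ⊗ H_R)}`. -/
def freeEvolution (M : Model HS HR) (t : ℝ) :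
    TraceClass (HS ⊗[ℂ] HR) →L[ℂ] TraceClass (HS ⊗[ℂ] HR) :=
  TraceClass.sandwich (M.freeOp t) (M.freeOp (-t))

/-- `ℒ_SR ρ = [W ⊗ V, ρ]`. -/
def LSR (M : Model HS HR) : TraceClass (HS ⊗[ℂ] HR) →L[ℂ] TraceClass (HS ⊗[ℂ] HR) :=
  TraceClass.sandwich (TensorProduct.mapL M.W M.V) (ContinuousLinearMap.id ℂ _) -
    TraceClass.sandwich (ContinuousLinearMap.id ℂ _) (TensorProduct.mapL M.W M.V)

/-- `ℒ_SR(s) = e^{isℒ₀} ℒ_SR e^{-isℒ₀}`. -/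
def LSRt (M : Model HS HR) (s : ℝ) :
    TraceClass (HS ⊗[ℂ] HR) →L[ℂ] TraceClass (HS ⊗[ℂ] HR) :=
  M.freeEvolution (-s) ∘L M.LSR ∘L M.freeEvolution s

/-- `ℒ_SR(z_k) Q ℒ_SR(z_{k-1}) Q ⋯ Q ℒ_SR(z_1) Q ℒ_SR P`. -/
def dysonChain (M : Model HS HR) :
    (k : ℕ) → (Fin k → ℝ) → TraceClass (HS ⊗[ℂ] HR) →L[ℂ] TraceClass (HS ⊗[ℂ] HR)
  | 0, _ => M.LSR ∘L M.P
  | k + 1, z => M.LSRt (z (Fin.last k)) ∘L M.Q ∘L M.dysonChain k (Fin.init z)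

/-- The integrand `P ℒ_SR(z_{n+1}) Q ℒ_SR(z_n) Q ⋯ Q ℒ_SR(z_1) Q ℒ_SR P` of `K_n`. -/
def dysonIntegrand (M : Model HS HR) (n : ℕ) (z : Fin (n + 1) → ℝ) :
    TraceClass (HS ⊗[ℂ] HR) →L[ℂ] TraceClass (HS ⊗[ℂ] HR) :=
  M.P ∘L M.dysonChain (n + 1) z

end Dyson

/-- The part `d_s^A` of the index sequence `(0, …, n+1)`: the indices of the block `s` of `d` that
lie in `A`, increasingly, followed by those that do not, decreasingly. -/
def rearrangedBlock {N : ℕ} (d : Composition N) (s : Fin d.length) (A : Finset (Fin N)) :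
    List (Fin N) :=
  (List.ofFn (d.embedding s)).filter (· ∈ A) ++
    ((List.ofFn (d.embedding s)).filter (· ∉ A)).reverse

/-- Partitions of `(0, …, N-1)` into contiguous subsequences of length larger than 1. -/
def NC (N : ℕ) : Finset (Composition N) :=
  Finset.univ.filter fun d => ∀ k ∈ d.blocks, 2 ≤ k

/-- The connected correlation function
`𝒢_n(A, z) = ∑_d (-1)^{|d|+1} ∏_s tr (∏_{k ∈ d_s^A} V(z_k) ω_R)` of the times `z_0, …, z_{n+1}`. -/
def G (M : Model HS HR) (n : ℕ) (A : Finset (Fin (n + 2))) (z : Fin (n + 2) → ℝ) : ℂ :=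
  ∑ d ∈ NC (n + 2), (-1) ^ (d.length + 1) *
    ∏ s : Fin d.length, trace (((rearrangedBlock d s A).map fun k => M.Vt (z k)).prod * M.ωR)

end Model

/-- The simplex `Δ^m(t) = {0 ≤ z_1 ≤ ⋯ ≤ z_m ≤ t}`. -/
def simplex (m : ℕ) (t : ℝ) : Set (Fin m → ℝ) :=
  {z | Monotone z ∧ ∀ i, z i ∈ Set.Icc 0 t}

/-- The gapped permutations of `{0, …, n+1}`: those with `|p(1) - p(0)| ≥ 2`. -/
def gappedPerms (n : ℕ) : Finset (Equiv.Perm (Fin (n + 2))) :=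
  Finset.univ.filter fun p => 2 ≤ |((p 1 : ℕ) : ℤ) - ((p 0 : ℕ) : ℤ)|

namespace Model

variable {HS HR : Type*}
  [NormedAddCommGroup HS] [InnerProductSpace ℂ HS] [CompleteSpace HS]
  [NormedAddCommGroup HR] [InnerProductSpace ℂ HR] [CompleteSpace HR]

/-- `f` and `C` are as in the definition of the clustering property of `(H_R, V, ω_R)`.  The
variables are `z = (z_1, …, z_{n+1})` in the simplex, and `z_0 = 0`. -/
structure IsClusteringPair (M : Model HS HR) (f : ℝ → ℝ) (C : ℝ) : Prop where
  nonneg : ∀ s, 0 ≤ f s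
  integrable : ∃ ε : ℝ, 0 < ε ∧ ε < 1 ∧ Integrable fun s => f s * (1 + |s|) ^ ε
  pos : 0 < C
  bound : ∀ n : ℕ, 1 ≤ n → ∀ A : Finset (Fin (n + 2)), ∀ t : ℝ, ∀ z ∈ simplex (n + 1) t,
    ‖M.G n A (Fin.cons 0 z)‖ ≤ C ^ (n + 2) / (n / 2).factorial *
      ∑ p ∈ gappedPerms n, ∏ l : Fin ((n + 1) / 2 + 1),
        f ((Fin.cons 0 z : Fin (n + 2) → ℝ) (p ⟨l, by omega⟩) -
          (Fin.cons 0 z : Fin (n + 2) → ℝ) (p ⟨l + 1, by omega⟩))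

/-- The operator `K_n(t) = ∫_{Δ^{n+1}(t)} P ℒ_SR(z_{n+1}) Q ⋯ Q ℒ_SR(z_1) Q ℒ_SR P dz`. -/
def K (M : Model HS HR) [FiniteDimensional ℂ HS] (n : ℕ) (t : ℝ) :
    TraceClass (HS ⊗[ℂ] HR) →L[ℂ] TraceClass (HS ⊗[ℂ] HR) :=
  ∫ z in simplex (n + 1) t, M.dysonIntegrand n z

/-- `c_n = (2C‖W‖)^{n+2} ‖f‖₁^{[(n+1)/2]+1} / [n/2]!`. -/
def c (M : Model HS HR) (f : ℝ → ℝ) (C : ℝ) (n : ℕ) : ℝ :=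
  (2 * C * ‖M.W‖) ^ (n + 2) / (n / 2).factorial * (∫ s, |f s|) ^ ((n + 1) / 2 + 1)

end Model

end WeakCoupling

end

/-! Algebra. Every `ℒ_SR(z_k)` is left multiplication by `W(z_k) ⊗ V(z_k)` minus right
multiplication by it, and the bare `ℒ_SR` is the same thing at `z_0 = 0`. So the integrand of `K_n`
is a sum over the `2^(n+2)` sets `A` of indices that act from the right. For fixed `A`, a stretch of
such multiplications applied to `σ ⊗ ω_R` keeps the reservoir factor of the form `|u⟩⟨u'|`; its
partial trace is a scalar correlation times the corresponding multiplications by `W(z_k)`. Writing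
each `Q` as `1 - P` cuts the chain into contiguous blocks, and the whole chain becomes a scalar
`S_{n+2}` times a product of system multiplications (`projectedChain_eq_sum`). The scalars obey a
recursion over the last block, solved by the signed sum over compositions
(`sum_composition_eq_connected`). Blocks of length one vanish because `tr(V ω_R) = 0` and `Ω_R` is
invariant, so `S_{n+2}` is `𝒢_n(A, z)` (`G_eq_connected`). Hence the integrand is bounded by
`‖W‖^(n+2) ∑_A |𝒢_n(A, z)|` (`norm_dysonIntegrand_le`).

Analysis. Insert the clustering bound and sum over all permutations `p`, grouped by the place `j =
p⁻¹(0)` of the fixed time `z_0 = 0`. For fixed `j` the permuted copies of the simplex overlap only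
in null sets and fill at most the cube `[0,t]^(n+1)`. On the cube, the chain of `[(n+1)/2]+1`
differences is integrated from its ends inwards: each difference yields `‖f‖₁` and the `[n/2]`
variables left over yield `t` each (`lintegral_chain_insertNth_le`). The `n + 2` places `j` give the
factor `n + 2` (`norm_K_le`). Since `n + 2 ≤ 2^(n+2)`, doubling `C` absorbs it. Integrability comes
from continuity of the integrand on the compact simplex. -/

namespace WeakCoupling

/-! ## Chains of left and right multiplications -/

section Multiplication

variable {H : Type*} [NormedAddCommGroup H] [InnerProductSpace ℂ H] [CompleteSpace H]

/-- Left multiplication by `T`, or minus right multiplication by `T` when `r` holds. -/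
noncomputable def signedMul (r : Prop) [Decidable r] (T : H →L[ℂ] H) :
    TraceClass H →L[ℂ] TraceClass H :=
  if r then -TraceClass.sandwich (ContinuousLinearMap.id ℂ _) T
  else TraceClass.sandwich T (ContinuousLinearMap.id ℂ _)

/-- The product of the signed multiplications by `T (j + m - 1), …, T j`, where the indices in `A`
act from the right. -/
noncomputable def mulProd (T : ℕ → H →L[ℂ] H) (A : Finset ℕ) (j : ℕ) :
    ℕ → TraceClass H →L[ℂ] TraceClass H
  | 0 => ContinuousLinearMap.id ℂ _
  | m + 1 => signedMul (j + m ∈ A) (T (j + m)) ∘L mulProd T A j m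

lemma TraceClass.norm_sandwich_le {K : Type*} [NormedAddCommGroup K] [InnerProductSpace ℂ K]
    [CompleteSpace K] (A : H →L[ℂ] K) (B : K →L[ℂ] H) :
    ‖TraceClass.sandwich A B‖ ≤ ‖A‖ * ‖B‖ :=
  LinearMap.mkContinuous_norm_le _ (by positivity) _

lemma norm_signedMul_le (r : Prop) [Decidable r] (T : H →L[ℂ] H) : ‖signedMul r T‖ ≤ ‖T‖ := by
  unfold signedMul
  split_ifs
  · rw [norm_neg]
    refine (TraceClass.norm_sandwich_le _ _).trans ?_
    exact mul_le_of_le_one_left (norm_nonneg _) ContinuousLinearMap.norm_id_le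
  · refine (TraceClass.norm_sandwich_le _ _).trans ?_
    exact mul_le_of_le_one_right (norm_nonneg _) ContinuousLinearMap.norm_id_le

lemma norm_mulProd_le {T : ℕ → H →L[ℂ] H} {c : ℝ} (hT : ∀ k, ‖T k‖ ≤ c) (A : Finset ℕ)
    (j m : ℕ) : ‖mulProd T A j m‖ ≤ c ^ m := by
  have hc : 0 ≤ c := (norm_nonneg _).trans (hT 0)
  induction m with
  | zero => simpa [mulProd] using ContinuousLinearMap.norm_id_le
  | succ m ih =>
    rw [mulProd, pow_succ']
    refine (ContinuousLinearMap.opNorm_comp_le _ _).trans ?_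
    gcongr
    exact (norm_signedMul_le _ _).trans (hT _)

lemma mulProd_comp (T : ℕ → H →L[ℂ] H) (A : Finset ℕ) (j m : ℕ) :
    mulProd T A j m ∘L mulProd T A 0 j = mulProd T A 0 (j + m) := by
  induction m with
  | zero => ext1; rfl
  | succ m ih => rw [mulProd, ContinuousLinearMap.comp_assoc, ih, ← add_assoc, mulProd, zero_add]

end Multiplication

/-! ## Rearranged products -/

/-- The indices `j, …, j + m - 1`: those in `A` increasingly, then those not in `A`
decreasingly. -/
def rearrangedRange (A : Finset ℕ) (j m : ℕ) : List ℕ :=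
  (List.range' j m).filter (· ∈ A) ++ ((List.range' j m).filter (· ∉ A)).reverse

section Reservoir

variable {HR : Type*} [NormedAddCommGroup HR] [InnerProductSpace ℂ HR] [CompleteSpace HR]

/-- The expectation in `Ω` of the rearranged product of `v j, …, v (j + m - 1)`. -/
noncomputable def blockCorrelation (v : ℕ → HR →L[ℂ] HR) (Ω : HR) (A : Finset ℕ) (j m : ℕ) : ℂ :=
  inner ℂ Ω (((rearrangedRange A j m).map v).prod Ω)

lemma inner_reverse_prod_left {v : ℕ → HR →L[ℂ] HR} (hv : ∀ k, IsSelfAdjoint (v k)) (l : List ℕ)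
    (x y : HR) : inner ℂ ((l.reverse.map v).prod x) y = inner ℂ x ((l.map v).prod y) := by
  induction l generalizing x with
  | nil => simp
  | cons k l ih =>
    simp only [List.reverse_cons, List.map_append, List.prod_append, List.map_cons, List.map_nil,
      List.prod_cons, List.prod_nil, mul_one]
    exact (ih (v k x)).trans ((hv k).isSymmetric x _)

/-- Right multiplications build up the bra and left multiplications the ket, in both cases with the
latest index outermost. Moving the bra operators across by self-adjointness reverses them, which
produces the order of `d_s^A`: increasing in `A`, then decreasing outside `A`. -/
lemma inner_eq_blockCorrelation {v : ℕ → HR →L[ℂ] HR} (hv : ∀ k, IsSelfAdjoint (v k)) (Ω : HR)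
    (A : Finset ℕ) (j m : ℕ) :
    inner ℂ ((((List.range' j m).filter (· ∈ A)).reverse.map v).prod Ω)
      ((((List.range' j m).filter (· ∉ A)).reverse.map v).prod Ω) =
      blockCorrelation v Ω A j m := by
  rw [inner_reverse_prod_left hv, blockCorrelation, rearrangedRange, List.map_append,
    List.prod_append]
  rfl

end Reservoir

/-! ### Partial traces of multiplication chains on the composite system -/

section Composite

variable {HS HR : Type*}
  [NormedAddCommGroup HS] [InnerProductSpace ℂ HS]
  [NormedAddCommGroup HR] [InnerProductSpace ℂ HR]

lemma mapL_comp_tensorRight (w : HS →L[ℂ] HS) (v : HR →L[ℂ] HR) (u : HR) :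
    TensorProduct.mapL w v ∘L tensorRight u = tensorRight (v u) ∘L w := by
  ext a
  simp

lemma norm_tensorRight_le (u : HR) : ‖tensorRight (HS := HS) u‖ ≤ ‖u‖ :=
  ContinuousLinearMap.opNorm_le_bound _ (norm_nonneg _) fun a => by
    rw [tensorRight_apply, TensorProduct.norm_tmul, mul_comm]

variable [FiniteDimensional ℂ HS] [CompleteSpace HS] [CompleteSpace HR]

lemma adjoint_tensorRight_comp (e u : HR) :
    (tensorRight (HS := HS) e).adjoint ∘L tensorRight u =
      inner ℂ e u • ContinuousLinearMap.id ℂ HS := by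
  ext a
  refine ext_inner_left ℂ fun c => ?_
  simp [ContinuousLinearMap.adjoint_inner_right, TensorProduct.inner_tmul, inner_smul_right,
    mul_comm]

lemma adjoint_tensorRight_comp_mapL (w : HS →L[ℂ] HS) {v : HR →L[ℂ] HR} (hv : IsSelfAdjoint v)
    (u : HR) : (tensorRight u).adjoint ∘L TensorProduct.mapL w v =
      w ∘L (tensorRight (HS := HS) (v u)).adjoint := by
  ext x
  refine ext_inner_left ℂ fun c => ?_
  simp only [ContinuousLinearMap.comp_apply, ContinuousLinearMap.adjoint_inner_right]
  rw [← ContinuousLinearMap.adjoint_inner_left w, ContinuousLinearMap.adjoint_inner_right]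
  induction x with
  | zero => simp
  | tmul a r =>
    have : inner ℂ u (v r) = inner ℂ (v u) r := (hv.isSymmetric u r).symm
    simp [TensorProduct.inner_tmul, this, ContinuousLinearMap.adjoint_inner_left]
  | add x y hx hy => rw [map_add, inner_add_right, inner_add_right, hx, hy]

/-- The partial trace of `σ ⊗ |u⟩⟨v|` is `⟨v, u⟩ σ`. -/
lemma partialTrace_comp_sandwich (u v : HR) :
    partialTrace HS HR ∘L TraceClass.sandwich (tensorRight u) (tensorRight v).adjoint =
      inner ℂ v u • ContinuousLinearMap.id ℂ (TraceClass HS) := by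
  ext1 σ
  change ∑' i, TraceClass.sandwich _ _ (TraceClass.sandwich _ _ σ) = inner ℂ v u • σ
  have h (i) : TraceClass.sandwich (tensorRight (HS := HS) (basis HR i)).adjoint
      (tensorRight (basis HR i))
      (TraceClass.sandwich (tensorRight u) (tensorRight v).adjoint σ) =
      (inner ℂ v (basis HR i) * inner ℂ (basis HR i) u) • σ := by
    ext1
    simp only [TraceClass.toOp_sandwich, map_smul]
    have h1 := adjoint_tensorRight_comp (HS := HS) (basis HR i) u
    have h2 := adjoint_tensorRight_comp (HS := HS) v (basis HR i)
    calc _ = ((tensorRight (HS := HS) (basis HR i)).adjoint ∘L tensorRight u) ∘L σ.toOp ∘L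
          ((tensorRight (HS := HS) v).adjoint ∘L tensorRight (basis HR i)) := rfl
      _ = _ := by
        rw [h1, h2]
        ext a
        simp [smul_smul]
  simp_rw [h]
  rw [((basis HR).summable_inner_mul_inner v u).tsum_smul_const, HilbertBasis.tsum_inner_mul_inner]

lemma norm_partialTrace_le : ‖partialTrace HS HR‖ ≤ 1 :=
  LinearMap.mkContinuous_norm_le _ zero_le_one _

lemma norm_tensorState_le (Ω : HR) : ‖tensorState HS Ω‖ ≤ ‖Ω‖ ^ 2 := by
  refine (TraceClass.norm_sandwich_le _ _).trans ?_
  rw [LinearIsometryEquiv.norm_map, sq]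
  gcongr <;> exact norm_tensorRight_le _

/-- The operator `w ⊗ v` acts on the ket from the left and on the bra from the right, so `σ ⊗
|u⟩⟨u'|` keeps its form. -/
lemma signedMul_comp_sandwich (r : Prop) [Decidable r] (w : HS →L[ℂ] HS) {v : HR →L[ℂ] HR}
    (hv : IsSelfAdjoint v) (u u' : HR) :
    signedMul r (TensorProduct.mapL w v) ∘L
        TraceClass.sandwich (tensorRight u) (tensorRight u').adjoint =
      TraceClass.sandwich (tensorRight (if r then u else v u))
        (tensorRight (if r then v u' else u')).adjoint ∘L signedMul r w := by
  ext1 σ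
  ext1
  unfold signedMul
  split_ifs
  · simp only [ContinuousLinearMap.comp_apply, neg_apply, map_neg,
      TraceClass.toOp_sandwich]
    have h := adjoint_tensorRight_comp_mapL w hv u'
    congr 1
    calc _ = tensorRight u ∘L σ.toOp ∘L ((tensorRight u').adjoint ∘L TensorProduct.mapL w v) := rfl
      _ = _ := by rw [h]; rfl
  · simp only [ContinuousLinearMap.comp_apply, TraceClass.toOp_sandwich]
    have h := mapL_comp_tensorRight w v u
    calc _ = (TensorProduct.mapL w v ∘L tensorRight u) ∘L σ.toOp ∘L (tensorRight u').adjoint := rfl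
      _ = _ := by rw [h]; rfl

lemma mulProd_comp_tensorState (w : ℕ → HS →L[ℂ] HS) {v : ℕ → HR →L[ℂ] HR}
    (hv : ∀ k, IsSelfAdjoint (v k)) (Ω : HR) (A : Finset ℕ) (j m : ℕ) :
    mulProd (fun k => TensorProduct.mapL (w k) (v k)) A j m ∘L tensorState HS Ω =
      TraceClass.sandwich
        (tensorRight ((((List.range' j m).filter (· ∉ A)).reverse.map v).prod Ω))
        (tensorRight ((((List.range' j m).filter (· ∈ A)).reverse.map v).prod Ω)).adjoint ∘L
      mulProd w A j m := by
  induction m with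
  | zero => ext1; simp [mulProd, tensorState]
  | succ m ih =>
    rw [mulProd, mulProd, ContinuousLinearMap.comp_assoc, ih, ← ContinuousLinearMap.comp_assoc,
      signedMul_comp_sandwich _ _ (hv _), ContinuousLinearMap.comp_assoc, List.range'_1_concat]
    by_cases h : j + m ∈ A <;> simp [h, List.filter_append]

/-- One block between two projections: the reservoir contributes only a number, and the system
multiplications survive unchanged. -/
lemma partialTrace_mulProd_tensorState (w : ℕ → HS →L[ℂ] HS) {v : ℕ → HR →L[ℂ] HR}
    (hv : ∀ k, IsSelfAdjoint (v k)) (Ω : HR) (A : Finset ℕ) (j m : ℕ) :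
    partialTrace HS HR ∘L mulProd (fun k => TensorProduct.mapL (w k) (v k)) A j m ∘L
        tensorState HS Ω = blockCorrelation v Ω A j m • mulProd w A j m := by
  rw [mulProd_comp_tensorState w hv, ← ContinuousLinearMap.comp_assoc, partialTrace_comp_sandwich,
    inner_eq_blockCorrelation hv]
  ext1; simp

/-! ## The connected correlation function by recursion over the last block -/

/-- `S 0 = -1` and `S N = -∑_{j < N} S j g(j, N - j)`. -/
noncomputable def connected (g : ℕ → ℕ → ℂ) (N : ℕ) : ℂ :=
  if N = 0 then -1 else -∑ j : Fin N, connected g j * g j (N - j)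

lemma connected_zero (g : ℕ → ℕ → ℂ) : connected g 0 = -1 := by
  rw [connected]; rfl

lemma connected_of_ne_zero (g : ℕ → ℕ → ℂ) {N : ℕ} (hN : N ≠ 0) :
    connected g N = -∑ j ∈ Finset.range N, connected g j * g j (N - j) := by
  rw [connected, if_neg hN, Finset.sum_range fun j => connected g j * g j (N - j)]

/-- The chain `X_N Q X_{N-1} Q ⋯ Q X_0 P` for signed multiplications `X_k`. -/
noncomputable def projectedChain (T : ℕ → HS ⊗[ℂ] HR →L[ℂ] HS ⊗[ℂ] HR) (Ω : HR) (A : Finset ℕ) :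
    ℕ → TraceClass (HS ⊗[ℂ] HR) →L[ℂ] TraceClass (HS ⊗[ℂ] HR)
  | 0 => signedMul (0 ∈ A) (T 0) ∘L tensorState HS Ω ∘L partialTrace HS HR
  | N + 1 => signedMul (N + 1 ∈ A) (T (N + 1)) ∘L
      (ContinuousLinearMap.id ℂ _ - tensorState HS Ω ∘L partialTrace HS HR) ∘L
      projectedChain T Ω A N

/-- In the first identity `j` is the position of the last `P` chosen when each `Q` is written as `1
- P`, and `S_j` collects all that happened before it. The two identities are proved together:
tracing the first at `N` gives the second at `N`, and the first at `N + 1` needs the second at `N`.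
-/
lemma projectedChain_eq_sum (w : ℕ → HS →L[ℂ] HS) {v : ℕ → HR →L[ℂ] HR}
    (hv : ∀ k, IsSelfAdjoint (v k)) (Ω : HR) (A : Finset ℕ) (N : ℕ) :
    projectedChain (fun k => TensorProduct.mapL (w k) (v k)) Ω A N =
        -∑ j ∈ Finset.range (N + 1), connected (blockCorrelation v Ω A) j •
          (mulProd (fun k => TensorProduct.mapL (w k) (v k)) A j (N + 1 - j) ∘L
            tensorState HS Ω ∘L mulProd w A 0 j ∘L partialTrace HS HR) ∧
      partialTrace HS HR ∘L projectedChain (fun k => TensorProduct.mapL (w k) (v k)) Ω A N =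
        connected (blockCorrelation v Ω A) (N + 1) •
          (mulProd w A 0 (N + 1) ∘L partialTrace HS HR) := by
  -- Each summand closes a last block `[j, N]` with correlation `g(j, N + 1 - j)`, so the partial
  -- trace reproduces the recursion that defines `S_(N+1)`.
  have trace_of_eq (N : ℕ)
      (h : projectedChain (fun k => TensorProduct.mapL (w k) (v k)) Ω A N =
        -∑ j ∈ Finset.range (N + 1), connected (blockCorrelation v Ω A) j •
          (mulProd (fun k => TensorProduct.mapL (w k) (v k)) A j (N + 1 - j) ∘L
            tensorState HS Ω ∘L mulProd w A 0 j ∘L partialTrace HS HR)) :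
      partialTrace HS HR ∘L projectedChain (fun k => TensorProduct.mapL (w k) (v k)) Ω A N =
        connected (blockCorrelation v Ω A) (N + 1) •
          (mulProd w A 0 (N + 1) ∘L partialTrace HS HR) := by
    rw [h, connected_of_ne_zero _ N.succ_ne_zero, ContinuousLinearMap.comp_neg,
      ContinuousLinearMap.comp_finsetSum, neg_smul, Finset.sum_smul]
    congr 1
    refine Finset.sum_congr rfl fun j hj => ?_
    have hj' : j + (N + 1 - j) = N + 1 := by have := Finset.mem_range.1 hj; omega
    have h1 := partialTrace_mulProd_tensorState w hv Ω A j (N + 1 - j)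
    have h2 := mulProd_comp w A j (N + 1 - j)
    rw [hj'] at h2
    rw [← h2, ContinuousLinearMap.comp_smul, mul_smul]
    congr 1
    calc _ = (partialTrace HS HR ∘L mulProd (fun k => TensorProduct.mapL (w k) (v k)) A j
            (N + 1 - j) ∘L tensorState HS Ω) ∘L mulProd w A 0 j ∘L partialTrace HS HR := rfl
      _ = _ := by rw [h1]; rfl
  induction N with
  | zero =>
    refine (fun h => ⟨h, trace_of_eq _ h⟩) ?_
    simp [projectedChain, mulProd, connected_zero]
  | succ N ih =>
    refine (fun h => ⟨h, trace_of_eq _ h⟩) ?_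
    rw [projectedChain, ContinuousLinearMap.sub_comp, ContinuousLinearMap.comp_assoc, ih.2,
      ContinuousLinearMap.id_comp, ContinuousLinearMap.comp_sub, Finset.sum_range_succ, neg_add,
      ← sub_eq_add_neg]
    congr 1
    · rw [ih.1, ContinuousLinearMap.comp_neg, ContinuousLinearMap.comp_finsetSum]
      congr 1
      refine Finset.sum_congr rfl fun j hj => ?_
      have hj' := Finset.mem_range.1 hj
      have h1 : N + 1 + 1 - j = (N + 1 - j) + 1 := by omega
      have h2 : j + (N + 1 - j) = N + 1 := by omega
      rw [ContinuousLinearMap.comp_smul, h1, mulProd, h2]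
      rfl
    -- The `-P` part of the newest `Q` is the new summand `j = N + 1`.
    · rw [ContinuousLinearMap.comp_smul, ContinuousLinearMap.comp_smul, Nat.add_sub_cancel_left]
      simp [mulProd]

end Composite

/-! ## Sums over compositions -/

/-- Appending a last block that completes a composition of `j` to a composition of `N > j`. -/
def appendLast {N : ℕ} (j : Fin N) (d : Composition j) : Composition N where
  blocks := d.blocks ++ [N - j]
  blocks_pos := by
    intro i hi
    rcases List.mem_append.1 hi with h | h
    · exact d.blocks_pos h
    · rw [List.mem_singleton] at h
      omega
  blocks_sum := by
    rw [List.sum_append, d.blocks_sum, List.sum_singleton]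
    omega

/-- The inverse removes the last block; for `N = 0` there is none to remove. -/
lemma appendLast_bijective {N : ℕ} (hN : N ≠ 0) :
    Function.Bijective fun x : Σ j : Fin N, Composition j => appendLast x.1 x.2 := by
  constructor
  · rintro ⟨j, d⟩ ⟨j', d'⟩ h
    have h1 : d.blocks ++ [N - (j : ℕ)] = d'.blocks ++ [N - (j' : ℕ)] :=
      congrArg Composition.blocks h
    obtain ⟨h2, h3⟩ := List.append_inj' h1 rfl
    rw [List.singleton_inj] at h3
    obtain rfl : j = j' := by ext; omega
    obtain rfl : d = d' := Composition.ext h2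
    rfl
  · intro d
    have hne : d.blocks ≠ [] := fun h => hN (d.blocks_eq_nil.1 h)
    have h1 := List.dropLast_append_getLast hne
    have h2 : d.blocks.dropLast.sum + d.blocks.getLast hne = N := by
      conv_rhs => rw [← d.blocks_sum, ← h1, List.sum_append, List.sum_singleton]
    have h3 : 0 < d.blocks.getLast hne := d.blocks_pos (List.getLast_mem hne)
    refine ⟨⟨⟨d.blocks.dropLast.sum, by omega⟩,
      ⟨d.blocks.dropLast, fun h => d.blocks_pos (List.mem_of_mem_dropLast h), rfl⟩⟩, ?_⟩
    refine Composition.ext ?_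
    change d.blocks.dropLast ++ [N - d.blocks.dropLast.sum] = d.blocks
    conv_rhs => rw [← h1]
    congr 2
    omega

lemma appendLast_length {N : ℕ} (j : Fin N) (d : Composition j) :
    (appendLast j d).length = d.length + 1 := by
  simp [appendLast, Composition.length]

lemma appendLast_sizeUpTo {N : ℕ} (j : Fin N) (d : Composition j) {i : ℕ} (hi : i ≤ d.length) :
    (appendLast j d).sizeUpTo i = d.sizeUpTo i := by
  simp only [appendLast, Composition.sizeUpTo]
  rw [List.take_append_of_le_length (by simpa using hi)]

/-- Splitting off the last block, which starts at `j`, costs one sign and one factor `g(j, N - j)`: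
this is the recursion. The empty composition of `0` has sign `(-1)^1`, hence the initial value `-1`.
-/
lemma sum_composition_eq_connected (g : ℕ → ℕ → ℂ) (N : ℕ) :
    ∑ d : Composition N, (-1) ^ (d.length + 1) * ∏ s ∈ Finset.range d.length,
      g (d.sizeUpTo s) (d.sizeUpTo (s + 1) - d.sizeUpTo s) = connected g N := by
  induction N using Nat.strong_induction_on with
  | _ N ih =>
    rcases eq_or_ne N 0 with rfl | hN
    · have h (d : Composition 0) : d.length = 0 := d.length_eq_zero.2 rfl
      simp [connected_zero, h, composition_card]
    · rw [connected_of_ne_zero g hN, ← (appendLast_bijective hN).sum_comp, Fintype.sum_sigma,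
        Finset.sum_range fun j => connected g j * g j (N - j), ← Finset.sum_neg_distrib]
      refine Finset.sum_congr rfl fun j _ => ?_
      rw [← ih j j.2, Finset.sum_mul, ← Finset.sum_neg_distrib]
      refine Finset.sum_congr rfl fun d _ => ?_
      have h1 : (appendLast j d).sizeUpTo (d.length + 1) = N := by
        rw [← appendLast_length, Composition.sizeUpTo_length]
      dsimp only
      rw [appendLast_length, Finset.prod_range_succ, h1, appendLast_sizeUpTo j d le_rfl,
        d.sizeUpTo_length]
      have h2 : ∏ s ∈ Finset.range d.length, g ((appendLast j d).sizeUpTo s)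
          ((appendLast j d).sizeUpTo (s + 1) - (appendLast j d).sizeUpTo s) =
          ∏ s ∈ Finset.range d.length,
            g (d.sizeUpTo s) (d.sizeUpTo (s + 1) - d.sizeUpTo s) := by
        refine Finset.prod_congr rfl fun s hs => ?_
        have hs' := Finset.mem_range.1 hs
        rw [appendLast_sizeUpTo j d hs'.le, appendLast_sizeUpTo j d hs']
      rw [h2]
      ring

lemma trace_mul_rankOne {H : Type*} [NormedAddCommGroup H] [InnerProductSpace ℂ H]
    [CompleteSpace H] (B : H →L[ℂ] H) (x y : H) :
    trace (B * rankOne ℂ x y) = inner ℂ y (B x) := by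
  rw [ContinuousLinearMap.mul_def, comp_rankOne, trace_rankOne]

/-! ### Reservoir expectations and the connected correlation function -/

namespace Model

variable {HS HR : Type*}
  [NormedAddCommGroup HS] [InnerProductSpace ℂ HS] [CompleteSpace HS]
  [NormedAddCommGroup HR] [InnerProductSpace ℂ HR] [CompleteSpace HR]

lemma op_neg (M : Model HS HR) (t : ℝ) : M.U.op (-t) = star (M.U.op t) := by
  have h1 : M.U.op (-t) * M.U.op t = 1 := by rw [← M.U.map_add, neg_add_cancel, M.U.map_zero]
  calc _ = M.U.op (-t) * (M.U.op t * star (M.U.op t)) := by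
        rw [Unitary.mul_star_self_of_mem (M.U.mem_unitary t), mul_one]
    _ = _ := by rw [← mul_assoc, h1, one_mul]

lemma isSelfAdjoint_Vt (M : Model HS HR) (t : ℝ) : IsSelfAdjoint (M.Vt t) := by
  rw [Vt, op_neg]
  exact M.V_selfAdjoint.conjugate' _

/-- The group law carries the vanishing derivative at time zero to every time, so the orbit of `Ω`
is constant. -/
lemma op_Ω (M : Model HS HR) (t : ℝ) : M.U.op t M.Ω = M.Ω := by
  obtain ⟨hd, h0⟩ := M.Ω_invariant
  have hd' : DifferentiableAt ℝ (fun t => M.U.op t M.Ω) 0 := hd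
  have h0' : Complex.I • deriv (fun t => M.U.op t M.Ω) 0 = 0 := h0
  have h1 : HasDerivAt (fun t => M.U.op t M.Ω) 0 0 := by
    have := hd'.hasDerivAt
    rwa [(smul_eq_zero.1 h0').resolve_left Complex.I_ne_zero] at this
  have h2 (s : ℝ) : HasDerivAt (fun t => M.U.op t M.Ω) 0 s := by
    have h3 : HasDerivAt (fun h => M.U.op s (M.U.op h M.Ω)) 0 0 := by
      have := ((M.U.op s).restrictScalars ℝ).hasFDerivAt.comp_hasDerivAt (0 : ℝ) h1
      rwa [_root_.map_zero] at this
    have h4 : HasDerivAt (fun t => M.U.op s (M.U.op (t - s) M.Ω)) 0 s := by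
      have h5 : HasDerivAt (fun h => M.U.op s (M.U.op h M.Ω)) 0 (s - s) := by rwa [sub_self]
      exact h5.comp_sub_const s s
    convert h4 using 2 with t
    rw [← mul_apply_eq_comp, ← M.U.map_add, add_sub_cancel]
  have h3 := is_const_of_deriv_eq_zero (f := fun t => M.U.op t M.Ω)
    (fun s => (h2 s).differentiableAt) (fun s => (h2 s).deriv) t 0
  simpa [M.U.map_zero] using h3

lemma inner_Vt_Ω (M : Model HS HR) (t : ℝ) : inner ℂ M.Ω (M.Vt t M.Ω) = 0 := by
  have h1 : inner ℂ M.Ω (M.V M.Ω) = 0 := by rw [← trace_mul_rankOne]; exact M.trace_V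
  have h2 : M.Vt t M.Ω = star (M.U.op t) (M.V (M.U.op t M.Ω)) := by rw [Vt, op_neg]; rfl
  rw [h2, ContinuousLinearMap.star_eq_adjoint, ContinuousLinearMap.adjoint_inner_right, op_Ω, h1]

/-- A tuple of times, extended by zero to all natural indices. -/
noncomputable def extendTimes {N : ℕ} (z : Fin N → ℝ) (k : ℕ) : ℝ :=
  if h : k < N then z ⟨k, h⟩ else 0

lemma map_val_ofFn_embedding {N : ℕ} (d : Composition N) (s : Fin d.length) :
    (List.ofFn (d.embedding s)).map Fin.val =
      List.range' (d.sizeUpTo s) (d.sizeUpTo (s + 1) - d.sizeUpTo s) := by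
  rw [d.sizeUpTo_succ', Nat.add_sub_cancel_left]
  refine List.ext_getElem (by simp) fun i h1 h2 => ?_
  simp [Composition.coe_embedding]

lemma map_val_rearrangedBlock {N : ℕ} (d : Composition N) (s : Fin d.length) (A : Finset ℕ) :
    (rearrangedBlock d s (Finset.univ.filter fun k : Fin N => (k : ℕ) ∈ A)).map Fin.val =
      rearrangedRange A (d.sizeUpTo s) (d.sizeUpTo (s + 1) - d.sizeUpTo s) := by
  rw [rearrangedRange, ← map_val_ofFn_embedding, rearrangedBlock, List.filter_map, List.filter_map]
  simp only [List.map_append, List.map_reverse, Function.comp_def, Finset.mem_filter,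
    Finset.mem_univ, true_and]

lemma trace_rearrangedBlock (M : Model HS HR) {N : ℕ} (z : Fin N → ℝ) (d : Composition N)
    (s : Fin d.length) (A : Finset ℕ) :
    trace (((rearrangedBlock d s (Finset.univ.filter fun k : Fin N => (k : ℕ) ∈ A)).map
        fun k => M.Vt (z k)).prod * M.ωR) =
      blockCorrelation (fun k => M.Vt (extendTimes z k)) M.Ω A (d.sizeUpTo s)
        (d.sizeUpTo (s + 1) - d.sizeUpTo s) := by
  rw [ωR, trace_mul_rankOne, blockCorrelation, ← map_val_rearrangedBlock, List.map_map]
  congr 4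
  ext k
  simp [extendTimes]

lemma blockCorrelation_one (M : Model HS HR) (z : ℕ → ℝ) (A : Finset ℕ) (j : ℕ) :
    blockCorrelation (fun k => M.Vt (z k)) M.Ω A j 1 = 0 := by
  by_cases h : j ∈ A <;> simp [blockCorrelation, rearrangedRange, h, inner_Vt_Ω]

/-- A block of length one contributes `⟨Ω, V(z_k) Ω⟩ = 0`, so the restriction to blocks of length at
least two can be dropped. -/
lemma G_eq_connected (M : Model HS HR) (n : ℕ) (A : Finset ℕ) (z : Fin (n + 2) → ℝ) :
    M.G n (Finset.univ.filter fun k : Fin (n + 2) => (k : ℕ) ∈ A) z =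
      connected (blockCorrelation (fun k => M.Vt (extendTimes z k)) M.Ω A) (n + 2) := by
  rw [← sum_composition_eq_connected, G]
  simp_rw [trace_rearrangedBlock, Finset.prod_range]
  refine Finset.sum_subset (Finset.subset_univ _) fun d _ hd => ?_
  simp only [NC, Finset.mem_filter, Finset.mem_univ, true_and, not_forall, not_le] at hd
  obtain ⟨k, hk, hk2⟩ := hd
  obtain rfl : k = 1 := by have := d.one_le_blocks hk; omega
  obtain ⟨i, hi, h1⟩ := List.mem_iff_getElem.1 hk
  refine mul_eq_zero_of_right _ (Finset.prod_eq_zero (Finset.mem_univ (⟨i, hi⟩ : Fin d.length)) ?_)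
  have h2 : d.sizeUpTo (i + 1) - d.sizeUpTo i = 1 := by
    rw [d.sizeUpTo_succ hi, Nat.add_sub_cancel_left, h1]
  simp only [h2, blockCorrelation_one]

end Model

/-! ## Integrals of chains -/

section Chains

open scoped ENNReal

/-- Take the value `∞` on a measurable null set containing all points where `f` differs from its
measurable representative. The clustering bound is pointwise while `f` is only a.e. measurable, so
the iterated integrals need a measurable majorant valid everywhere. -/
lemma exists_measurable_ge_ae_eq {α : Type*} [MeasurableSpace α] {μ : Measure α} {f : α → ℝ≥0∞}
    (hf : AEMeasurable f μ) : ∃ g, Measurable g ∧ f ≤ g ∧ g =ᵐ[μ] f := by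
  classical
  have h0 : μ (toMeasurable μ {x | f x ≠ hf.mk f x}) = 0 := by
    rw [measure_toMeasurable]; exact hf.ae_eq_mk
  refine ⟨(toMeasurable μ {x | f x ≠ hf.mk f x}).piecewise (fun _ => ∞) (hf.mk f),
    measurable_const.piecewise (measurableSet_toMeasurable _ _) hf.measurable_mk, fun x => ?_, ?_⟩
  · by_cases hx : x ∈ toMeasurable μ {x | f x ≠ hf.mk f x}
    · rw [Set.piecewise_eq_of_mem _ _ _ hx]; exact le_top
    · rw [Set.piecewise_eq_of_notMem _ _ _ hx]
      by_contra h
      exact hx (subset_toMeasurable _ _ fun h' => h h'.le)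
  · have h1 : ∀ᵐ x ∂μ, x ∉ toMeasurable μ {x | f x ≠ hf.mk f x} := measure_eq_zero_iff_ae_notMem.1 h0
    filter_upwards [h1, hf.ae_eq_mk] with x hx hx'
    rw [Set.piecewise_eq_of_notMem _ _ _ hx, hx']

/-- Successive integration of a product of weights, each of which depends on its own variable and
on variables of smaller rank. -/
lemma lmarginal_prod_le {ι : Type*} [DecidableEq ι] (ν : ι → Measure ℝ) [∀ i, SigmaFinite (ν i)]
    (rank : ι → ℕ) {w : ι → (ι → ℝ) → ℝ≥0∞} (hw : ∀ i, Measurable (w i))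
    (hdep : ∀ a x x', (∀ i, i = a ∨ rank i < rank a → x i = x' i) → w a x = w a x')
    {c : ι → ℝ≥0∞} (hc : ∀ a x, ∫⁻ s, w a (Function.update x a s) ∂ν a ≤ c a)
    (s : Finset ι) (x : ι → ℝ) :
    (∫⋯∫⁻_s, (fun x => ∏ i ∈ s, w i x) ∂ν) x ≤ ∏ i ∈ s, c i := by
  induction s using Finset.induction_on_min_value rank generalizing x with
  | empty => simp
  | insert a s ha hmin ih =>
    rw [lmarginal_insert _ (Finset.measurable_prod _ fun i _ => hw i) ha, Finset.prod_insert ha]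
    -- The rank of `a` is minimal, so `w a` does not involve the variables in `s` and comes out of
    -- their integrals; the variables of larger rank are thus integrated first.
    have h1 (y : ι → ℝ) : (∫⋯∫⁻_s, (fun x => ∏ i ∈ insert a s, w i x) ∂ν) y ≤
        w a y * ∏ i ∈ s, c i := by
      refine le_trans (le_of_eq ?_) (mul_le_mul_right (ih y) _)
      simp only [lmarginal, Finset.prod_insert ha]
      rw [← lintegral_const_mul]
      · refine lintegral_congr fun u => ?_
        congr 1
        refine hdep a _ _ fun i hi => ?_
        have his : i ∉ s := by
          rcases hi with rfl | hi
          · exact ha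
          · exact fun h => absurd (hmin i h) (not_le.2 hi)
        simp [Function.updateFinset, his]
      · exact (Finset.measurable_prod _ fun i _ => hw i).comp measurable_updateFinset
    calc _ ≤ ∫⁻ u, w a (Function.update x a u) * ∏ i ∈ s, c i ∂ν a :=
          lintegral_mono fun u => h1 _
      _ = (∫⁻ u, w a (Function.update x a u) ∂ν a) * ∏ i ∈ s, c i :=
          lintegral_mul_const _ ((hw a).comp (measurable_update x))
      _ ≤ _ := by gcongr; exact hc a x

/-- The vertices `i ≠ r` of the path `0, …, m + 1` correspond to its edges: each vertex takes the
edge towards `r`, which is edge `i` before the root and edge `i - 1` after it. The root and the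
vertices off the path carry `b`. -/
lemma prod_range_chain {M : Type*} [CommMonoid M] (a b : ℕ → M) {r m K : ℕ} (hr : r ≤ m + 1)
    (hm : m + 1 < K) :
    ∏ i ∈ Finset.range K, (if i < r then a i else if i = r then b r else
        if i ≤ m + 1 then a (i - 1) else b i) =
      (∏ l ∈ Finset.range (m + 1), a l) * (b r * ∏ i ∈ Finset.Ico (m + 2) K, b i) := by
  rw [← Finset.prod_range_mul_prod_Ico _ (show m + 2 ≤ K by omega),
    ← Finset.prod_range_mul_prod_Ico _ (show r + 1 ≤ m + 2 by omega), Finset.prod_range_succ,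
    ← Finset.prod_range_mul_prod_Ico a hr]
  have h1 : ∏ i ∈ Finset.range r, (if i < r then a i else if i = r then b r else
      if i ≤ m + 1 then a (i - 1) else b i) = ∏ i ∈ Finset.range r, a i :=
    Finset.prod_congr rfl fun i hi => if_pos (Finset.mem_range.1 hi)
  have h2 : ∏ i ∈ Finset.Ico (r + 1) (m + 2), (if i < r then a i else if i = r then b r else
      if i ≤ m + 1 then a (i - 1) else b i) = ∏ i ∈ Finset.Ico r (m + 1), a i := by
    rw [Finset.prod_Ico_eq_prod_range, Finset.prod_Ico_eq_prod_range]
    refine Finset.prod_congr (by congr 1; omega) fun i hi => ?_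
    have := Finset.mem_range.1 hi
    rw [if_neg (by omega), if_neg (by omega), if_pos (by omega)]
    congr 1
    omega
  have h3 : ∏ i ∈ Finset.Ico (m + 2) K, (if i < r then a i else if i = r then b r else
      if i ≤ m + 1 then a (i - 1) else b i) = ∏ i ∈ Finset.Ico (m + 2) K, b i := by
    refine Finset.prod_congr rfl fun i hi => ?_
    have := Finset.mem_Ico.1 hi
    rw [if_neg (by omega), if_neg (by omega), if_neg (by omega)]
  rw [h1, h2, h3, if_neg (lt_irrefl r), if_pos rfl]
  simp only [mul_assoc, mul_comm, mul_left_comm]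

open Model in
/-- A chain of differences is integrated from its ends towards the root `r`. -/
lemma lintegral_chain_le {K m r : ℕ} (hr : r ≤ m + 1) (hm : m + 1 < K) (ν : ℕ → Measure ℝ)
    [∀ i, SigmaFinite (ν i)] (hν : ∀ i, i ≠ r → i ≤ m + 1 → ν i ≤ volume) {g : ℝ → ℝ≥0∞}
    (hg : Measurable g) :
    ∫⁻ x, ∏ l ∈ Finset.range (m + 1), g (extendTimes x l - extendTimes x (l + 1))
        ∂Measure.pi (fun i : Fin K => ν i) ≤
      (∫⁻ s, g s) ^ (m + 1) * (ν r Set.univ * ∏ i ∈ Finset.Ico (m + 2) K, ν i Set.univ) := by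
  have hX (i : ℕ) : Measurable fun x : Fin K → ℝ => extendTimes x i := by
    unfold extendTimes
    split_ifs
    · exact measurable_pi_apply _
    · exact measurable_const
  have hval (x : Fin K → ℝ) (i : Fin K) : extendTimes x i = x i := by simp [extendTimes]
  have hupd (x : Fin K → ℝ) (a : Fin K) (s : ℝ) (k : ℕ) (hk : k ≠ a) :
      extendTimes (Function.update x a s) k = extendTimes x k := by
    unfold extendTimes
    split_ifs with h
    · rw [Function.update_of_ne]
      exact fun h' => hk (congrArg Fin.val h')
    · rfl
  -- Each vertex of the path other than the root is charged with the edge leading towards the root;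
  -- all others have weight one.
  let w (i : Fin K) (x : Fin K → ℝ) : ℝ≥0∞ :=
    if (i : ℕ) < r then g (extendTimes x i - extendTimes x (i + 1)) else if (i : ℕ) = r then 1 else
      if (i : ℕ) ≤ m + 1 then g (extendTimes x (i - 1) - extendTimes x (i - 1 + 1)) else 1
  let c (i : Fin K) : ℝ≥0∞ :=
    if (i : ℕ) < r then ∫⁻ s, g s else if (i : ℕ) = r then ν r Set.univ else
      if (i : ℕ) ≤ m + 1 then ∫⁻ s, g s else ν i Set.univ
  -- The rank is the distance to the root, so that an edge depends on its own vertex and on one of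
  -- smaller rank.
  have key := lmarginal_prod_le (fun i : Fin K => ν i) (fun i => ((i : ℤ) - r).natAbs) (w := w)
    (c := c) ?_ ?_ ?_ Finset.univ 0
  · rw [lmarginal_univ] at key
    refine le_trans (le_of_eq (lintegral_congr fun x => ?_)) (key.trans (le_of_eq ?_))
    · simp only [w]
      rw [Fin.prod_univ_eq_prod_range (fun i : ℕ => if i < r then
        g (extendTimes x i - extendTimes x (i + 1)) else if i = r then 1 else
        if i ≤ m + 1 then g (extendTimes x (i - 1) - extendTimes x (i - 1 + 1)) else 1),
        prod_range_chain (fun i => g (extendTimes x i - extendTimes x (i + 1))) (fun _ => 1) hr hm]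
      simp
    · simp only [c]
      rw [Fin.prod_univ_eq_prod_range (fun i : ℕ => if i < r then ∫⁻ s, g s else
        if i = r then ν r Set.univ else if i ≤ m + 1 then ∫⁻ s, g s else ν i Set.univ),
        prod_range_chain (fun _ => ∫⁻ s, g s) (fun i => ν i Set.univ) hr hm]
      simp
  · intro i
    have h1 (k : ℕ) : Measurable fun x : Fin K → ℝ =>
        g (extendTimes x k - extendTimes x (k + 1)) := hg.comp ((hX _).sub (hX _))
    simp only [w]
    split_ifs
    · exact h1 _
    · exact measurable_const
    · exact h1 _
    · exact measurable_const
  · intro a x x' h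
    have h1 (k : ℕ) (hk : k = a ∨ ((k : ℤ) - r).natAbs < ((a : ℤ) - r).natAbs) :
        extendTimes x k = extendTimes x' k := by
      unfold extendTimes
      split_ifs with hkK
      · refine h ⟨k, hkK⟩ ?_
        rcases hk with hk | hk
        · exact Or.inl (Fin.ext hk)
        · exact Or.inr hk
      · rfl
    simp only [w]
    split_ifs with h2 h3 h4
    · rw [h1 a (Or.inl rfl), h1 (a + 1) (Or.inr (by push_cast; omega))]
    · rfl
    · rw [h1 (a - 1) (Or.inr (by omega)), h1 (a - 1 + 1) (Or.inl (by omega))]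
    · rfl
  · intro a x
    simp only [w, c]
    split_ifs with h2 h3 h4
    · calc _ = ∫⁻ s, g (s - extendTimes x (a + 1)) ∂ν a := by
            refine lintegral_congr fun s => ?_
            rw [hval, hupd _ _ _ _ (by omega), Function.update_self]
        _ ≤ ∫⁻ s, g (s - extendTimes x (a + 1)) :=
            lintegral_mono' (hν a (by omega) (by omega)) le_rfl
        _ = _ := lintegral_sub_right_eq_self g _
        _ ≤ _ := le_rfl
    · rw [lintegral_const, one_mul, h3]
    · have h5 : (a : ℕ) - 1 + 1 = a := by omega
      calc _ = ∫⁻ s, g (extendTimes x (a - 1) - s) ∂ν a := by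
            refine lintegral_congr fun s => ?_
            rw [h5, hval, hupd _ _ _ _ (by omega), Function.update_self]
        _ ≤ ∫⁻ s, g (extendTimes x (a - 1) - s) :=
            lintegral_mono' (hν a h3 h4) le_rfl
        _ = _ := lintegral_sub_left_eq_self g _
        _ ≤ _ := le_rfl
    · rw [lintegral_const, one_mul]

open Model in
/-- A chain with one variable fixed to be zero and the others in `[0, t]`. -/
lemma lintegral_chain_insertNth_le (n : ℕ) (j : Fin (n + 2)) (t : ℝ) {g : ℝ → ℝ≥0∞}
    (hg : Measurable g) :
    ∫⁻ y in Set.univ.pi fun _ : Fin (n + 1) => Set.Icc 0 t,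
        ∏ l ∈ Finset.range ((n + 1) / 2 + 1),
          g (extendTimes (j.insertNth (α := fun _ => ℝ) 0 y) l -
            extendTimes (j.insertNth (α := fun _ => ℝ) 0 y) (l + 1)) ≤
      (∫⁻ s, g s) ^ ((n + 1) / 2 + 1) * ENNReal.ofReal t ^ (n / 2) := by
  -- The fixed time becomes a Dirac mass, so that all `n + 2` coordinates form one product measure.
  let ν (i : ℕ) : Measure ℝ := if i = j then Measure.dirac 0 else volume.restrict (Set.Icc 0 t)
  have hνj : ν j = Measure.dirac 0 := if_pos rfl
  have hνne (i : ℕ) (hi : i ≠ j) : ν i = volume.restrict (Set.Icc 0 t) := if_neg hi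
  have hfin (i : ℕ) : IsFiniteMeasure (ν i) := by
    by_cases h : i = j
    · rw [h, hνj]; infer_instance
    · rw [hνne i h]; infer_instance
  have hmass (i : ℕ) : ν i Set.univ = if i = j then 1 else ENNReal.ofReal t := by
    split_ifs with h
    · rw [h, hνj]; simp
    · rw [hνne i h]; simp
  have hX (i : ℕ) : Measurable fun x : Fin (n + 2) → ℝ => extendTimes x i := by
    unfold extendTimes
    split_ifs
    · exact measurable_pi_apply _
    · exact measurable_const
  have hF : Measurable fun x : Fin (n + 2) → ℝ => ∏ l ∈ Finset.range ((n + 1) / 2 + 1),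
      g (extendTimes x l - extendTimes x (l + 1)) :=
    Finset.measurable_prod _ fun l _ => hg.comp ((hX _).sub (hX _))
  -- The root is the fixed vertex `j` if it lies on the path, and otherwise the end vertex `(n + 1)
  -- / 2 + 1`.
  have h1 := lintegral_chain_le (K := n + 2) (m := (n + 1) / 2) (r := min j ((n + 1) / 2 + 1))
    (min_le_right _ _) (by omega) ν (fun i hi hi' => by
      rw [hνne i (by omega)]
      exact Measure.restrict_le_self) hg
  have h2 := (measurePreserving_piFinSuccAbove (fun i : Fin (n + 2) => ν i) j).symm
  have h3 : (Measure.pi fun i : Fin (n + 1) => ν (j.succAbove i)) =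
      volume.restrict (Set.univ.pi fun _ : Fin (n + 1) => Set.Icc 0 t) := by
    have : ∀ i : Fin (n + 1), ν (j.succAbove i) = volume.restrict (Set.Icc 0 t) := fun i =>
      hνne _ fun h => j.succAbove_ne i (Fin.ext h)
    simp_rw [this]
    rw [volume_pi, Measure.restrict_pi_pi]
  rw [← h2.lintegral_comp hF, h3, hνj, Measure.dirac_prod, lintegral_map _ measurable_prodMk_left]
    at h1
  · refine h1.trans (le_of_eq ?_)
    congr 1
    simp only [hmass]
    -- There are `n / 2` vertices off the path. If `j` is on the path, each of them has mass `t` and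
    -- the root has mass one. Otherwise `j` is one of them, with mass one, and the root supplies the
    -- missing `t`.
    by_cases hj : (j : ℕ) ≤ (n + 1) / 2 + 1
    · rw [if_pos (by omega), one_mul, Finset.prod_congr rfl (g := fun _ => ENNReal.ofReal t),
        Finset.prod_const, Nat.card_Ico]
      · congr 1
        omega
      · intro i hi
        have := Finset.mem_Ico.1 hi
        rw [if_neg (by omega)]
    · have hmem : (j : ℕ) ∈ Finset.Ico ((n + 1) / 2 + 2) (n + 2) := by
        rw [Finset.mem_Ico]; omega
      rw [if_neg (by omega), ← Finset.mul_prod_erase _ _ hmem, if_pos rfl, one_mul,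
        Finset.prod_congr rfl (g := fun _ => ENNReal.ofReal t), Finset.prod_const,
        Finset.card_erase_of_mem hmem, Nat.card_Ico, ← pow_succ']
      · congr 1
        have := Finset.mem_Ico.1 hmem
        omega
      · intro i hi
        exact if_neg (Finset.ne_of_mem_erase hi)
  · exact hF.comp (MeasurableEquiv.measurable _)

/-! ### The simplex and its images under permutations -/

lemma isClosed_simplex (m : ℕ) (t : ℝ) : IsClosed (simplex m t) := by
  have : simplex m t = (⋂ i, ⋂ j, ⋂ (_ : i ≤ j), {z : Fin m → ℝ | z i ≤ z j}) ∩
      ⋂ i, {z : Fin m → ℝ | z i ∈ Set.Icc 0 t} := by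
    ext z
    simp [simplex, Monotone]
  rw [this]
  refine IsClosed.inter ?_ ?_
  · exact isClosed_iInter fun i => isClosed_iInter fun j => isClosed_iInter fun _ =>
      isClosed_le (continuous_apply i) (continuous_apply j)
  · exact isClosed_iInter fun i => isClosed_Icc.preimage (continuous_apply i)

lemma isCompact_simplex (m : ℕ) (t : ℝ) : IsCompact (simplex m t) := by
  refine (isCompact_univ_pi fun _ : Fin m => isCompact_Icc (a := (0 : ℝ)) (b := t)).of_isClosed_subset
    (isClosed_simplex m t) fun z hz i _ => hz.2 i

/-- The diagonals `y a = y b` are proper subspaces, hence null. -/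
lemma ae_injective (m : ℕ) : ∀ᵐ y : Fin m → ℝ, Function.Injective y := by
  have h (a b : Fin m) : ∀ᵐ y : Fin m → ℝ, a ≠ b → y a ≠ y b := by
    by_cases hab : a = b
    · simp [hab]
    have h0 := Measure.addHaar_submodule (volume : Measure (Fin m → ℝ))
      (LinearMap.ker (LinearMap.proj (R := ℝ) (φ := fun _ : Fin m => ℝ) a - LinearMap.proj b)) (by
        intro htop
        have : Pi.single a (1 : ℝ) ∈ LinearMap.ker
            (LinearMap.proj (R := ℝ) (φ := fun _ : Fin m => ℝ) a - LinearMap.proj b) := by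
          rw [htop]; trivial
        simp [Ne.symm hab] at this)
    filter_upwards [measure_eq_zero_iff_ae_notMem.1 h0] with y hy _ hyab
    exact hy (by simp [hyab])
  filter_upwards [ae_all_iff.2 fun a => ae_all_iff.2 fun b => h a b] with y hy a b hab
  by_contra hne
  exact hy a b hne hab

/-- The images of the simplex under permutations of the coordinates have null intersections and
lie in the cube. -/
lemma sum_lintegral_simplex_comp_le (m : ℕ) (t : ℝ) {F : (Fin m → ℝ) → ℝ≥0∞} (hF : Measurable F) :
    ∑ e : Equiv.Perm (Fin m), ∫⁻ z in simplex m t, F (z ∘ e) ≤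
      ∫⁻ y in Set.univ.pi fun _ : Fin m => Set.Icc 0 t, F y := by
  have hS : MeasurableSet (simplex m t) := (isClosed_simplex m t).measurableSet
  have hcomp (e : Equiv.Perm (Fin m)) :
      Measurable fun y : Fin m → ℝ => y ∘ e := measurable_pi_lambda _ fun i => measurable_pi_apply _
  -- A volume-preserving change of variables moves the permutation from the integrand to the domain.
  have h1 (e : Equiv.Perm (Fin m)) : ∫⁻ z in simplex m t, F (z ∘ e) =
      ∫⁻ y, ((fun y : Fin m → ℝ => y ∘ e.symm) ⁻¹' simplex m t).indicator F y := by
    have hmp : MeasurePreserving (fun y : Fin m → ℝ => y ∘ e) volume volume := by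
      convert volume_measurePreserving_piCongrLeft (fun _ : Fin m => ℝ) e.symm using 1
      ext y i
      have := MeasurableEquiv.piCongrLeft_apply_apply (β := fun _ : Fin m => ℝ) e.symm y (e i)
      rw [e.symm_apply_apply] at this
      exact this.symm
    rw [lintegral_indicator (hcomp _ hS), ← hmp.setLIntegral_comp_preimage (hcomp _ hS) hF]
    have : (fun y : Fin m → ℝ => y ∘ e) ⁻¹' ((fun y : Fin m → ℝ => y ∘ e.symm) ⁻¹' simplex m t) =
        simplex m t := by
      ext z
      simp [Function.comp_assoc]
    rw [this]
  simp_rw [h1]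
  rw [← lintegral_finsetSum' _ fun e _ => (hF.indicator (hcomp _ hS)).aemeasurable,
    ← lintegral_indicator (MeasurableSet.univ_pi fun _ => measurableSet_Icc)]
  refine lintegral_mono_ae ?_
  filter_upwards [ae_injective m] with y hy
  by_cases hex : ∃ e : Equiv.Perm (Fin m), y ∘ e.symm ∈ simplex m t
  · obtain ⟨e, he⟩ := hex
    -- A tuple without repetitions is sorted by exactly one permutation, so at most one indicator is
    -- nonzero at `y`.
    have huniq (e' : Equiv.Perm (Fin m)) (he' : y ∘ e'.symm ∈ simplex m t) : e' = e := by
      have h2 (e : Equiv.Perm (Fin m)) (he : y ∘ e.symm ∈ simplex m t) :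
          e.symm = Tuple.sort y := Tuple.eq_sort_iff.2
        ⟨he.1, fun i j hij h => absurd (e.symm.injective (hy h)) hij.ne⟩
      exact Equiv.symm_bijective.injective ((h2 e' he').trans (h2 e he).symm)
    rw [Finset.sum_eq_single e, Set.indicator_of_mem (by exact he), Set.indicator_of_mem]
    · intro i _
      simpa using he.2 (e i)
    · exact fun e' _ hne => Set.indicator_of_notMem (by exact fun h => hne (huniq e' h)) _
    · simp
  · push Not at hex
    rw [Finset.sum_eq_zero fun e _ => Set.indicator_of_notMem (by exact hex e) _]
    exact zero_le

/-! ### Permutations classified by the place of the fixed time -/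

/-- The permutation of `Fin (m + 1)` that maps `j` to `0` and is `e` on the other indices. -/
def permInsert {m : ℕ} (j : Fin (m + 1)) (e : Equiv.Perm (Fin m)) : Equiv.Perm (Fin (m + 1)) :=
  (finSuccEquiv' j).trans ((Equiv.optionCongr e).trans (finSuccEquiv m).symm)

lemma permInsert_self {m : ℕ} (j : Fin (m + 1)) (e : Equiv.Perm (Fin m)) :
    permInsert j e j = 0 := by simp [permInsert]

lemma permInsert_succAbove {m : ℕ} (j : Fin (m + 1)) (e : Equiv.Perm (Fin m)) (i : Fin m) :
    permInsert j e (j.succAbove i) = (e i).succ := by simp [permInsert]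

lemma permInsert_bijective (m : ℕ) :
    Function.Bijective fun x : Fin (m + 1) × Equiv.Perm (Fin m) => permInsert x.1 x.2 := by
  rw [Fintype.bijective_iff_injective_and_card]
  constructor
  · rintro ⟨j, e⟩ ⟨j', e'⟩ h
    have h' : permInsert j e = permInsert j' e' := h
    obtain rfl : j = j' := by
      apply (permInsert j e).injective
      rw [permInsert_self, h', permInsert_self]
    obtain rfl : e = e' := by
      ext i
      have := congrArg (fun p => p (j.succAbove i)) h'
      simp only [permInsert_succAbove] at this
      exact congrArg Fin.val (Fin.succ_injective _ this)
    rfl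
  · simp [Fintype.card_perm, Nat.factorial_succ]

lemma cons_comp_permInsert {m : ℕ} (z : Fin m → ℝ) (j : Fin (m + 1)) (e : Equiv.Perm (Fin m)) :
    (Fin.cons 0 z : Fin (m + 1) → ℝ) ∘ permInsert j e =
      j.insertNth (α := fun _ => ℝ) 0 (z ∘ e) := by
  ext i
  rcases Fin.eq_self_or_eq_succAbove j i with rfl | ⟨i, rfl⟩
  · simp [permInsert_self]
  · simp [permInsert_succAbove]

open Model in
-- For each place `j` of the time zero, the sum over the other `n + 1` indices merges the simplex
-- integrals into one cube integral. Summing over `j` is the only source of the factor `n + 2`.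
lemma sum_perm_lintegral_chain_le (n : ℕ) (t : ℝ) {g : ℝ → ℝ≥0∞} (hg : Measurable g) :
    ∑ p : Equiv.Perm (Fin (n + 2)), ∫⁻ z in simplex (n + 1) t,
        ∏ l ∈ Finset.range ((n + 1) / 2 + 1),
          g (extendTimes ((Fin.cons 0 z : Fin (n + 2) → ℝ) ∘ p) l -
            extendTimes ((Fin.cons 0 z : Fin (n + 2) → ℝ) ∘ p) (l + 1)) ≤
      (n + 2) * ((∫⁻ s, g s) ^ ((n + 1) / 2 + 1) * ENNReal.ofReal t ^ (n / 2)) := by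
  rw [← (permInsert_bijective (n + 1)).sum_comp, Fintype.sum_prod_type]
  simp only [cons_comp_permInsert]
  have hX (j : Fin (n + 2)) (i : ℕ) : Measurable fun y : Fin (n + 1) → ℝ =>
      extendTimes (j.insertNth (α := fun _ => ℝ) 0 y) i := by
    unfold extendTimes
    split_ifs with h
    · rcases Fin.eq_self_or_eq_succAbove j ⟨i, h⟩ with h' | ⟨i', h'⟩
      · simp [h']
      · simp [h', measurable_pi_apply]
    · exact measurable_const
  calc _ ≤ ∑ j : Fin (n + 2), (∫⁻ s, g s) ^ ((n + 1) / 2 + 1) * ENNReal.ofReal t ^ (n / 2) := by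
        refine Finset.sum_le_sum fun j _ => ?_
        refine le_trans ?_ (lintegral_chain_insertNth_le n j t hg)
        exact sum_lintegral_simplex_comp_le (n + 1) t
          (F := fun y => ∏ l ∈ Finset.range ((n + 1) / 2 + 1),
            g (extendTimes (j.insertNth (α := fun _ => ℝ) 0 y) l -
              extendTimes (j.insertNth (α := fun _ => ℝ) 0 y) (l + 1)))
          (Finset.measurable_prod _ fun l _ => hg.comp ((hX _ _).sub (hX _ _)))
    _ = _ := by
        rw [Finset.sum_const, Finset.card_univ, Fintype.card_fin, nsmul_eq_mul]
        push_cast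
        ring

end Chains

/-! ### The couplings in the interaction picture -/

lemma norm_le_one_of_mem_unitary {H : Type*} [NormedAddCommGroup H] [InnerProductSpace ℂ H]
    [CompleteSpace H] {u : H →L[ℂ] H} (hu : u ∈ unitary (H →L[ℂ] H)) : ‖u‖ ≤ 1 := by
  have h1 : ‖u‖ * ‖u‖ ≤ 1 := by
    rw [← CStarRing.norm_star_mul_self, Unitary.star_mul_self_of_mem hu]
    exact ContinuousLinearMap.norm_id_le
  nlinarith [norm_nonneg u]

lemma TraceClass.sandwich_comp {H K L : Type*} [NormedAddCommGroup H] [InnerProductSpace ℂ H]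
    [CompleteSpace H] [NormedAddCommGroup K] [InnerProductSpace ℂ K] [CompleteSpace K]
    [NormedAddCommGroup L] [InnerProductSpace ℂ L] [CompleteSpace L] (A : K →L[ℂ] L)
    (B : L →L[ℂ] K) (A' : H →L[ℂ] K) (B' : K →L[ℂ] H) :
    TraceClass.sandwich A B ∘L TraceClass.sandwich A' B' =
      TraceClass.sandwich (A ∘L A') (B' ∘L B) := by
  ext1 ρ
  ext1
  rfl

namespace Model

variable {HS HR : Type*}
  [NormedAddCommGroup HS] [InnerProductSpace ℂ HS] [CompleteSpace HS]
  [NormedAddCommGroup HR] [InnerProductSpace ℂ HR] [CompleteSpace HR]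

/-- `e^{-itH_S}`. -/
noncomputable def expS (M : Model HS HR) (t : ℝ) : HS →L[ℂ] HS :=
  NormedSpace.exp ((-(Complex.I * (t : ℂ))) • M.hamS)

/-- `W(t) = e^{itH_S} W e^{-itH_S}`. -/
noncomputable def Wt (M : Model HS HR) (t : ℝ) : HS →L[ℂ] HS := M.expS (-t) * M.W * M.expS t

lemma norm_expS_le (M : Model HS HR) (t : ℝ) : ‖M.expS t‖ ≤ 1 := by
  let : NormedAlgebra ℚ (HS →L[ℂ] HS) := NormedAlgebra.restrictScalars ℚ ℂ (HS →L[ℂ] HS)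
  refine norm_le_one_of_mem_unitary (NormedSpace.exp_mem_unitary_of_mem_skewAdjoint ?_)
  rw [skewAdjoint.mem_iff, star_smul, M.hamS_selfAdjoint.star_eq]
  simp

lemma norm_Wt_le (M : Model HS HR) (t : ℝ) : ‖M.Wt t‖ ≤ ‖M.W‖ := by
  calc _ ≤ ‖M.expS (-t)‖ * ‖M.W‖ * ‖M.expS t‖ := norm_mul₃_le
    _ ≤ 1 * ‖M.W‖ * 1 := by gcongr <;> exact M.norm_expS_le _
    _ = _ := by ring

lemma continuous_Wt (M : Model HS HR) : Continuous M.Wt := by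
  let : NormedAlgebra ℚ (HS →L[ℂ] HS) := NormedAlgebra.restrictScalars ℚ ℂ (HS →L[ℂ] HS)
  have h : Continuous M.expS := by
    refine NormedSpace.exp_continuous.comp ?_
    fun_prop
  exact ((h.comp continuous_neg).mul continuous_const).mul h

lemma expS_neg_mul (M : Model HS HR) (t : ℝ) : M.expS (-t) * M.expS t = 1 := by
  let : NormedAlgebra ℚ (HS →L[ℂ] HS) := NormedAlgebra.restrictScalars ℚ ℂ (HS →L[ℂ] HS)
  have h : Commute ((-(Complex.I * ((-t : ℝ) : ℂ))) • M.hamS) ((-(Complex.I * (t : ℂ))) • M.hamS) :=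
    ((Commute.refl M.hamS).smul_left _).smul_right _
  rw [expS, expS, ← NormedSpace.exp_add_of_commute h, ← add_smul]
  simp

lemma freeOp_neg_mul (M : Model HS HR) (t : ℝ) : M.freeOp (-t) ∘L M.freeOp t = 1 := by
  have h1 : M.U.op (-t) * M.U.op t = 1 := by rw [← M.U.map_add, neg_add_cancel, M.U.map_zero]
  change TensorProduct.mapL (M.expS (-t)) (M.U.op (-t)) * TensorProduct.mapL (M.expS t) (M.U.op t) = 1
  rw [← TensorProduct.mapL_mul, expS_neg_mul, h1]
  exact TensorProduct.mapL_id_id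

lemma freeOp_conj (M : Model HS HR) (t : ℝ) :
    M.freeOp (-t) ∘L TensorProduct.mapL M.W M.V ∘L M.freeOp t =
      TensorProduct.mapL (M.Wt t) (M.Vt t) := by
  change TensorProduct.mapL (M.expS (-t)) (M.U.op (-t)) * (TensorProduct.mapL M.W M.V *
    TensorProduct.mapL (M.expS t) (M.U.op t)) = _
  rw [← mul_assoc, ← TensorProduct.mapL_mul, ← TensorProduct.mapL_mul]
  rfl

/-- Strong continuity together with the uniform bound `‖U(s)‖ ≤ 1` gives joint continuity in time
and vector. -/
lemma continuous_op_apply (M : Model HS HR) {X : Type*} [TopologicalSpace X] {s : X → ℝ}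
    {y : X → HR} (hs : Continuous s) (hy : Continuous y) :
    Continuous fun a => M.U.op (s a) (y a) := by
  rw [continuous_iff_continuousAt]
  intro a
  have h1 : Tendsto (fun b => ‖y b - y a‖ + ‖M.U.op (s b) (y a) - M.U.op (s a) (y a)‖) (𝓝 a)
      (𝓝 0) := by
    have h2 : Continuous fun b =>
        ‖y b - y a‖ + ‖M.U.op (s b) (y a) - M.U.op (s a) (y a)‖ := by
      have h3 : Continuous fun b => M.U.op (s b) (y a) := (M.U.continuous (y a)).comp hs
      fun_prop
    simpa using h2.tendsto a
  refine tendsto_iff_norm_sub_tendsto_zero.2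
    (squeeze_zero (fun _ => norm_nonneg _) (fun b => ?_) h1)
  have h4 : M.U.op (s b) (y b) - M.U.op (s a) (y a) =
      M.U.op (s b) (y b - y a) + (M.U.op (s b) (y a) - M.U.op (s a) (y a)) := by
    rw [map_sub]; abel
  rw [h4]
  refine (norm_add_le _ _).trans ?_
  gcongr
  refine ((M.U.op (s b)).le_opNorm _).trans ?_
  exact mul_le_of_le_one_left (norm_nonneg _) (norm_le_one_of_mem_unitary (M.U.mem_unitary _))

lemma continuous_prod_Vt_apply (M : Model HS HR) {X : Type*} [TopologicalSpace X] {s : X → ℕ → ℝ}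
    (hs : ∀ k, Continuous fun a => s a k) (l : List ℕ) (x : HR) :
    Continuous fun a => (l.map fun k => M.Vt (s a k)).prod x := by
  induction l with
  | nil => exact continuous_const
  | cons k l ih =>
    have h : Continuous fun a =>
        M.U.op (-s a k) (M.V (M.U.op (s a k) ((l.map fun k => M.Vt (s a k)).prod x))) :=
      M.continuous_op_apply (hs k).neg
        (M.V.continuous.comp (M.continuous_op_apply (hs k) ih))
    exact h

/-! ### Expansion of the Dyson series -/

section Dyson

variable [FiniteDimensional ℂ HS]

lemma LSRt_eq (M : Model HS HR) (t : ℝ) :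
    M.LSRt t = TraceClass.sandwich (TensorProduct.mapL (M.Wt t) (M.Vt t))
        (ContinuousLinearMap.id ℂ _) -
      TraceClass.sandwich (ContinuousLinearMap.id ℂ _)
        (TensorProduct.mapL (M.Wt t) (M.Vt t)) := by
  have h1 := M.freeOp_conj t
  have h2 := M.freeOp_neg_mul t
  rw [LSRt, freeEvolution, freeEvolution, LSR, neg_neg, ContinuousLinearMap.sub_comp,
    ContinuousLinearMap.comp_sub, TraceClass.sandwich_comp, TraceClass.sandwich_comp,
    TraceClass.sandwich_comp, TraceClass.sandwich_comp, ContinuousLinearMap.id_comp,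
    ContinuousLinearMap.comp_id, ContinuousLinearMap.comp_assoc (M.freeOp (-t)), h1, h2]
  rfl

/-- Makes the rightmost, undotted coupling of the chain one more factor of the common kind, at time
`z_0 = 0`. -/
lemma LSRt_zero (M : Model HS HR) : M.LSRt 0 = M.LSR := by
  have h1 : M.Wt 0 = M.W := by simp [Wt, expS]
  have h2 : M.Vt 0 = M.V := by simp [Vt, M.U.map_zero]
  rw [LSRt_eq, h1, h2, LSR]

lemma projectedChain_congr {T T' : ℕ → HS ⊗[ℂ] HR →L[ℂ] HS ⊗[ℂ] HR} (Ω : HR) {A A' : Finset ℕ}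
    {N : ℕ} (hT : ∀ k ≤ N, T k = T' k) (hA : ∀ k ≤ N, k ∈ A ↔ k ∈ A') :
    projectedChain T Ω A N = projectedChain T' Ω A' N := by
  induction N with
  | zero => simp [projectedChain, hT 0 le_rfl, hA 0 le_rfl]
  | succ N ih =>
    rw [projectedChain, projectedChain,
      ih (fun k hk => hT k (hk.trans N.le_succ)) fun k hk => hA k (hk.trans N.le_succ)]
    simp only [hT (N + 1) le_rfl, hA (N + 1) le_rfl]

/-- The interaction-picture couplings at the times `0, z_1, z_2, …`. -/
noncomputable def coupling (M : Model HS HR) {N : ℕ} (z : Fin N → ℝ) (k : ℕ) :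
    HS ⊗[ℂ] HR →L[ℂ] HS ⊗[ℂ] HR :=
  TensorProduct.mapL (M.Wt (extendTimes (Fin.cons 0 z : Fin (N + 1) → ℝ) k))
    (M.Vt (extendTimes (Fin.cons 0 z : Fin (N + 1) → ℝ) k))

/-- Each new commutator offers two choices, left (`k + 1 ∉ A`) or right (`k + 1 ∈ A`), matching the
splitting of the power set when `k + 1` is inserted. The sign of a right choice sits in `signedMul`.
-/
lemma dysonChain_eq_sum (M : Model HS HR) (k : ℕ) (z : Fin k → ℝ) :
    M.dysonChain k z =
      ∑ A ∈ (Finset.range (k + 1)).powerset, projectedChain (M.coupling z) M.Ω A k := by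
  induction k with
  | zero =>
    rw [zero_add, Finset.range_one, ← insert_empty_eq, Finset.sum_powerset_insert (by simp)]
    simp only [Finset.powerset_empty, Finset.sum_singleton, projectedChain, signedMul,
      Finset.notMem_empty, if_false, Finset.mem_insert_self, if_true, dysonChain, ← M.LSRt_zero,
      LSRt_eq, P, ← ContinuousLinearMap.add_comp, coupling, sub_eq_add_neg]
    rfl
  | succ k ih =>
    rw [dysonChain, ih, Finset.range_add_one (n := k + 1), Finset.sum_powerset_insert (by simp),
      ← Finset.sum_add_distrib, ContinuousLinearMap.comp_finsetSum,
      ContinuousLinearMap.comp_finsetSum]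
    refine Finset.sum_congr rfl fun A hA => ?_
    have hmem : k + 1 ∉ A := fun h => by simpa using Finset.mem_powerset.1 hA h
    have hT (i : ℕ) (hi : i ≤ k) : M.coupling (Fin.init z) i = M.coupling z i := by
      have : extendTimes (Fin.cons 0 (Fin.init z) : Fin (k + 1) → ℝ) i =
          extendTimes (Fin.cons 0 z : Fin (k + 1 + 1) → ℝ) i := by
        rw [extendTimes, extendTimes, dif_pos (by omega), dif_pos (by omega)]
        rcases i with _ | i
        · rfl
        · rfl
      rw [coupling, coupling, this]
    have hlast : M.coupling z (k + 1) =
        TensorProduct.mapL (M.Wt (z (Fin.last k))) (M.Vt (z (Fin.last k))) := by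
      have : extendTimes (Fin.cons 0 z : Fin (k + 1 + 1) → ℝ) (k + 1) = z (Fin.last k) := by
        rw [extendTimes, dif_pos (by omega)]
        rfl
      rw [coupling, this]
    rw [projectedChain, projectedChain, signedMul, signedMul, if_neg hmem,
      if_pos (Finset.mem_insert_self _ _), hlast, LSRt_eq,
      projectedChain_congr M.Ω hT (fun i _ => Iff.rfl),
      projectedChain_congr (A := insert (k + 1) A) (A' := A) M.Ω (fun i _ => rfl) (fun i hi => by
        rw [Finset.mem_insert, or_iff_right (by omega)]),
      ← ContinuousLinearMap.add_comp, ← sub_eq_add_neg]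
    rfl

lemma dysonIntegrand_eq_sum (M : Model HS HR) (n : ℕ) (z : Fin (n + 1) → ℝ) :
    M.dysonIntegrand n z = ∑ A ∈ (Finset.range (n + 2)).powerset,
      connected (blockCorrelation
        (fun k => M.Vt (extendTimes (Fin.cons 0 z : Fin (n + 2) → ℝ) k)) M.Ω A) (n + 2) •
        (tensorState HS M.Ω ∘L
          mulProd (fun k => M.Wt (extendTimes (Fin.cons 0 z : Fin (n + 2) → ℝ) k)) A 0 (n + 2) ∘L
          partialTrace HS HR) := by
  rw [dysonIntegrand, dysonChain_eq_sum, ContinuousLinearMap.comp_finsetSum]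
  refine Finset.sum_congr rfl fun A _ => ?_
  have h := (projectedChain_eq_sum
    (fun k => M.Wt (extendTimes (Fin.cons 0 z : Fin (n + 2) → ℝ) k))
    (fun k => M.isSelfAdjoint_Vt (extendTimes (Fin.cons 0 z : Fin (n + 2) → ℝ) k))
    M.Ω A (n + 1)).2
  rw [← ContinuousLinearMap.comp_smul, ← h]
  rfl

lemma norm_dysonIntegrand_le (M : Model HS HR) (n : ℕ) (z : Fin (n + 1) → ℝ) :
    ‖M.dysonIntegrand n z‖ ≤ ∑ A ∈ (Finset.range (n + 2)).powerset,
      ‖M.G n (Finset.univ.filter fun k : Fin (n + 2) => (k : ℕ) ∈ A) (Fin.cons 0 z)‖ *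
        ‖M.W‖ ^ (n + 2) := by
  rw [dysonIntegrand_eq_sum]
  refine norm_sum_le_of_le _ fun A _ => ?_
  rw [norm_smul, G_eq_connected]
  gcongr
  refine (ContinuousLinearMap.opNorm_comp_le _ _).trans ?_
  have h1 : ‖tensorState HS M.Ω‖ ≤ 1 := by
    simpa [M.norm_Ω] using norm_tensorState_le (HS := HS) M.Ω
  have h2 : ‖mulProd (fun k => M.Wt (extendTimes (Fin.cons 0 z : Fin (n + 2) → ℝ) k)) A 0 (n + 2)‖ ≤
      ‖M.W‖ ^ (n + 2) := norm_mulProd_le (fun k => M.norm_Wt_le _) A 0 (n + 2)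
  calc _ ≤ 1 * (‖M.W‖ ^ (n + 2) * 1) := by
        gcongr
        refine (ContinuousLinearMap.opNorm_comp_le _ _).trans ?_
        gcongr
        exact norm_partialTrace_le
    _ = _ := by ring

/-! ### Continuity of the integrand -/

lemma continuous_connected {X : Type*} [TopologicalSpace X] {g : X → ℕ → ℕ → ℂ}
    (hg : ∀ j m, Continuous fun a => g a j m) (N : ℕ) :
    Continuous fun a => connected (g a) N := by
  induction N using Nat.strong_induction_on with
  | _ N ih =>
    rcases eq_or_ne N 0 with rfl | hN
    · simp only [connected_zero]; exact continuous_const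
    · simp only [connected_of_ne_zero _ hN]
      exact (continuous_finsetSum _ fun j hj =>
        (ih j (Finset.mem_range.1 hj)).mul (hg _ _)).neg

lemma continuous_signedMul {H : Type*} [NormedAddCommGroup H] [InnerProductSpace ℂ H]
    [CompleteSpace H] (r : Prop) [Decidable r] : Continuous fun T : H →L[ℂ] H => signedMul r T := by
  refine (LipschitzWith.of_dist_le_mul (K := 1) fun S T => ?_).continuous
  have h : signedMul r S - signedMul r T = signedMul r (S - T) := by
    ext1 ρ
    ext1
    unfold signedMul
    split_ifs <;> ext x <;> simp [sub_eq_add_neg, add_comm]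
  rw [dist_eq_norm, dist_eq_norm, h, NNReal.coe_one, one_mul]
  exact norm_signedMul_le _ _

lemma continuous_mulProd {H : Type*} [NormedAddCommGroup H] [InnerProductSpace ℂ H]
    [CompleteSpace H] {X : Type*} [TopologicalSpace X] {T : X → ℕ → H →L[ℂ] H}
    (hT : ∀ k, Continuous fun a => T a k) (A : Finset ℕ) (j m : ℕ) :
    Continuous fun a => mulProd (T a) A j m := by
  induction m with
  | zero => exact continuous_const
  | succ m ih => exact ((continuous_signedMul _).comp (hT _)).clm_comp ih

/-- `V(t)` is in general only strongly continuous. In the expanded form, however, it enters only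
through vectors obtained by applying it to `Ω`, while `W(t)` is norm continuous; so the integrand is
continuous in operator norm. -/
lemma continuous_dysonIntegrand (M : Model HS HR) (n : ℕ) : Continuous (M.dysonIntegrand n) := by
  have hs (k : ℕ) : Continuous fun z : Fin (n + 1) → ℝ =>
      extendTimes (Fin.cons 0 z : Fin (n + 2) → ℝ) k := by
    unfold extendTimes
    split_ifs with h
    · rcases k with _ | k
      · exact continuous_const
      · exact continuous_apply (⟨k, by omega⟩ : Fin (n + 1))
    · exact continuous_const
  have h : M.dysonIntegrand n = fun z => _ := funext fun z => M.dysonIntegrand_eq_sum n z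
  rw [h]
  refine continuous_finsetSum _ fun A _ => Continuous.fun_smul ?_ ?_
  · exact continuous_connected
      (fun j m => continuous_const.inner (M.continuous_prod_Vt_apply hs _ _)) _
  · exact continuous_const.clm_comp ((continuous_mulProd
      (fun k => M.continuous_Wt.comp (hs k)) A 0 (n + 2)).clm_comp continuous_const)

lemma integrableOn_dysonIntegrand (M : Model HS HR) (n : ℕ) (t : ℝ) :
    IntegrableOn (M.dysonIntegrand n) (simplex (n + 1) t) :=
  (M.continuous_dysonIntegrand n).continuousOn.integrableOn_compact (isCompact_simplex _ _)

/-! ### Norm bounds -/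

omit [FiniteDimensional ℂ HS] in
-- The weight is at least one, so it dominates; measurability of `f` returns on dividing by the
-- weight.
lemma IsClusteringPair.integrable_self {M : Model HS HR} {f : ℝ → ℝ} {C : ℝ}
    (h : M.IsClusteringPair f C) : Integrable f := by
  obtain ⟨ε, hε, -, hi⟩ := h.integrable
  have h1 (s : ℝ) : 1 ≤ (1 + |s|) ^ ε :=
    Real.one_le_rpow (by linarith [abs_nonneg s]) hε.le
  have hm : Measurable fun s : ℝ => ((1 + |s|) ^ ε)⁻¹ := by fun_prop
  refine hi.mono ?_ (ae_of_all _ fun s => ?_)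
  · refine (hi.aestronglyMeasurable.mul hm.aestronglyMeasurable).congr (ae_of_all _ fun s => ?_)
    have : (1 + |s|) ^ ε ≠ 0 := by linarith [h1 s]
    simp [mul_assoc, mul_inv_cancel₀ this]
  · rw [norm_mul, Real.norm_of_nonneg (zero_le_one.trans (h1 s))]
    exact le_mul_of_one_le_right (norm_nonneg _) (h1 s)

omit [FiniteDimensional ℂ HS] in
lemma IsClusteringPair.mono {M : Model HS HR} {f : ℝ → ℝ} {C C' : ℝ}
    (h : M.IsClusteringPair f C) (hC : C ≤ C') : M.IsClusteringPair f C' where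
  nonneg := h.nonneg
  integrable := h.integrable
  pos := h.pos.trans_le hC
  bound n hn A t z hz := by
    refine (h.bound n hn A t z hz).trans ?_
    have := h.pos
    gcongr
    exact Finset.sum_nonneg fun p _ => Finset.prod_nonneg fun l _ => h.nonneg _

lemma enorm_dysonIntegrand_le {M : Model HS HR} {f : ℝ → ℝ} {C : ℝ}
    (hf : M.IsClusteringPair f C) {g : ℝ → ENNReal} (hg : ∀ s, ENNReal.ofReal (f s) ≤ g s) {n : ℕ}
    (hn : 1 ≤ n) {t : ℝ} {z : Fin (n + 1) → ℝ} (hz : z ∈ simplex (n + 1) t) :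
    ‖M.dysonIntegrand n z‖ₑ ≤
      ENNReal.ofReal ((2 * C * ‖M.W‖) ^ (n + 2) / (n / 2).factorial) *
        ∑ p : Equiv.Perm (Fin (n + 2)), ∏ l ∈ Finset.range ((n + 1) / 2 + 1),
          g (extendTimes ((Fin.cons 0 z : Fin (n + 2) → ℝ) ∘ p) l -
            extendTimes ((Fin.cons 0 z : Fin (n + 2) → ℝ) ∘ p) (l + 1)) := by
  have hC := hf.pos
  have h1 : ‖M.dysonIntegrand n z‖ ≤ (2 * C * ‖M.W‖) ^ (n + 2) / (n / 2).factorial *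
      ∑ p ∈ gappedPerms n, ∏ l : Fin ((n + 1) / 2 + 1),
        f ((Fin.cons 0 z : Fin (n + 2) → ℝ) (p ⟨l, by omega⟩) -
          (Fin.cons 0 z : Fin (n + 2) → ℝ) (p ⟨l + 1, by omega⟩)) := by
    refine (M.norm_dysonIntegrand_le n z).trans ?_
    refine (Finset.sum_le_sum fun A _ =>
      mul_le_mul_of_nonneg_right (hf.bound n hn _ t z hz) (by positivity)).trans_eq ?_
    -- The `2^(n+2)` sets `A` account for the factor `2` in `2 C ‖W‖`.
    rw [Finset.sum_const, Finset.card_powerset, Finset.card_range, nsmul_eq_mul]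
    push_cast
    ring
  rw [← ofReal_norm]
  refine (ENNReal.ofReal_le_ofReal h1).trans ?_
  rw [ENNReal.ofReal_mul (by positivity), ENNReal.ofReal_sum_of_nonneg fun p _ =>
    Finset.prod_nonneg fun l _ => hf.nonneg _]
  gcongr
  -- The terms are nonnegative, so the sum may be enlarged to all permutations.
  refine (Finset.sum_le_sum fun p _ => ?_).trans
    (Finset.sum_le_sum_of_subset (Finset.subset_univ _))
  rw [ENNReal.ofReal_prod_of_nonneg fun l _ => hf.nonneg _, Finset.prod_range]
  refine Finset.prod_le_prod' fun l _ => (hg _).trans_eq ?_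
  rw [extendTimes, extendTimes, dif_pos (by omega), dif_pos (by omega)]
  rfl

lemma norm_K_le {M : Model HS HR} {f : ℝ → ℝ} {C : ℝ} (hf : M.IsClusteringPair f C) {n : ℕ}
    (hn : 1 ≤ n) {t : ℝ} (ht : 0 < t) : ‖M.K n t‖ ≤ (n + 2) * M.c f C n * t ^ (n / 2) := by
  have hC := hf.pos
  have hfi := hf.integrable_self
  obtain ⟨g, hgm, hg, hge⟩ := exists_measurable_ge_ae_eq hfi.aestronglyMeasurable.aemeasurable.ennreal_ofReal
  have hgint : ∫⁻ s, g s = ENNReal.ofReal (∫ s, |f s|) := by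
    rw [lintegral_congr_ae hge, ← ofReal_integral_eq_lintegral_ofReal hfi (ae_of_all _ hf.nonneg)]
    simp only [abs_of_nonneg (hf.nonneg _)]
  have hI : 0 ≤ ∫ s, |f s| := integral_nonneg fun s => abs_nonneg _
  have hX (p : Equiv.Perm (Fin (n + 2))) (k : ℕ) : Measurable fun z : Fin (n + 1) → ℝ =>
      extendTimes ((Fin.cons 0 z : Fin (n + 2) → ℝ) ∘ p) k := by
    unfold extendTimes
    split_ifs with h
    · simp only [Function.comp_apply]
      rcases Fin.eq_zero_or_eq_succ (p ⟨k, h⟩) with h' | ⟨i, h'⟩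
      · simp [h']
      · simp [h', measurable_pi_apply]
    · exact measurable_const
  have hmeas (p : Equiv.Perm (Fin (n + 2))) : Measurable fun z : Fin (n + 1) → ℝ =>
      ∏ l ∈ Finset.range ((n + 1) / 2 + 1),
        g (extendTimes ((Fin.cons 0 z : Fin (n + 2) → ℝ) ∘ p) l -
          extendTimes ((Fin.cons 0 z : Fin (n + 2) → ℝ) ∘ p) (l + 1)) :=
    Finset.measurable_prod _ fun l _ => hgm.comp ((hX _ _).sub (hX _ _))
  have hR : 0 ≤ (n + 2) * M.c f C n * t ^ (n / 2) := by unfold c; positivity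
  rw [← ENNReal.ofReal_le_ofReal_iff hR, ofReal_norm]
  calc ‖M.K n t‖ₑ ≤ ∫⁻ z in simplex (n + 1) t, ‖M.dysonIntegrand n z‖ₑ :=
        enorm_integral_le_lintegral_enorm _
    _ ≤ ∫⁻ z in simplex (n + 1) t,
        ENNReal.ofReal ((2 * C * ‖M.W‖) ^ (n + 2) / (n / 2).factorial) *
        ∑ p : Equiv.Perm (Fin (n + 2)), ∏ l ∈ Finset.range ((n + 1) / 2 + 1),
          g (extendTimes ((Fin.cons 0 z : Fin (n + 2) → ℝ) ∘ p) l -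
            extendTimes ((Fin.cons 0 z : Fin (n + 2) → ℝ) ∘ p) (l + 1)) :=
        setLIntegral_mono' (isClosed_simplex _ _).measurableSet fun z hz =>
          enorm_dysonIntegrand_le hf hg hn hz
    _ ≤ ENNReal.ofReal ((2 * C * ‖M.W‖) ^ (n + 2) / (n / 2).factorial) *
        ((n + 2) * ((∫⁻ s, g s) ^ ((n + 1) / 2 + 1) * ENNReal.ofReal t ^ (n / 2))) := by
        rw [lintegral_const_mul _ (Finset.measurable_sum _ fun p _ => hmeas p),
          lintegral_finsetSum _ fun p _ => hmeas p]
        gcongr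
        exact sum_perm_lintegral_chain_le n t hgm
    _ = _ := by
        have hn2 : ((n : ENNReal) + 2) = ENNReal.ofReal (n + 2) := by
          rw [ENNReal.ofReal_add (by positivity) (by norm_num), ENNReal.ofReal_natCast]
          norm_num
        rw [hgint, hn2, ← ENNReal.ofReal_pow hI, ← ENNReal.ofReal_pow ht.le,
          ← ENNReal.ofReal_mul (by positivity), ← ENNReal.ofReal_mul (by positivity),
          ← ENNReal.ofReal_mul (by positivity), c]
        congr 1
        ring

/-! ### The constants `c_n` and their power series -/

omit [FiniteDimensional ℂ HS] in
lemma c_two_mul (M : Model HS HR) (f : ℝ → ℝ) (C : ℝ) (n : ℕ) :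
    M.c f (2 * C) n = 2 ^ (n + 2) * M.c f C n := by
  rw [c, c, show 2 * (2 * C) * ‖M.W‖ = 2 * (2 * C * ‖M.W‖) by ring, mul_pow]
  ring

/-- The even and the odd terms are each an exponential series in `R ^ 2`, up to a factor `R`. -/
lemma _root_.Real.summable_pow_div_factorial_half (R : ℝ) :
    Summable fun n : ℕ => R ^ n / (n / 2).factorial := by
  have h := Real.summable_pow_div_factorial (R ^ 2)
  have h0 : (fun k : ℕ => R ^ (2 * k) / ((2 * k / 2).factorial : ℝ)) =
      fun k => (R ^ 2) ^ k / k.factorial := by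
    funext k
    rw [Nat.mul_div_cancel_left k two_pos, pow_mul]
  have h1 : (fun k : ℕ => R ^ (2 * k + 1) / (((2 * k + 1) / 2).factorial : ℝ)) =
      fun k => R * ((R ^ 2) ^ k / k.factorial) := by
    funext k
    rw [show (2 * k + 1) / 2 = k by omega, pow_succ, pow_mul]
    ring
  refine (HasSum.even_add_odd (f := fun n : ℕ => R ^ n / ((n / 2).factorial : ℝ))
    (m := ∑' k : ℕ, (R ^ 2) ^ k / k.factorial)
    (m' := R * ∑' k : ℕ, (R ^ 2) ^ k / k.factorial) ?_ ?_).summable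
  · rw [h0]
    exact h.hasSum
  · rw [h1]
    exact h.hasSum.mul_left R

omit [FiniteDimensional ℂ HS] in
lemma summable_c_mul_pow (M : Model HS HR) (f : ℝ → ℝ) (C s : ℝ) :
    Summable fun n : ℕ => M.c f C (n + 1) * s ^ (n + 1) := by
  -- Bases of at least one allow all exponents to be raised to `n + 3`, leaving a single power `(a *
  -- b * d) ^ (n + 3)`.
  set a := max 1 |2 * C * ‖M.W‖|
  set b := max 1 (∫ s, |f s|)
  set d := max 1 |s|
  have ha : 1 ≤ a := le_max_left _ _
  have hb : 1 ≤ b := le_max_left _ _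
  have hd : 1 ≤ d := le_max_left _ _
  have hI : 0 ≤ ∫ s, |f s| := integral_nonneg fun s => abs_nonneg _
  have hs := ((summable_nat_add_iff 1).2
    (Real.summable_pow_div_factorial_half (a * b * d))).mul_left ((a * b * d) ^ 2)
  refine Summable.of_norm_bounded hs fun n => ?_
  rw [c, norm_mul, norm_mul, norm_div, norm_pow, norm_pow, norm_pow, Real.norm_eq_abs,
    Real.norm_eq_abs (∫ s, |f s|), abs_of_nonneg hI, Real.norm_eq_abs s, Real.norm_natCast]
  calc _ ≤ a ^ (n + 3) / ((n + 1) / 2).factorial * b ^ (n + 3) * d ^ (n + 3) := by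
        gcongr
        · exact le_max_right _ _
        · exact (pow_le_pow_left₀ hI (le_max_right _ _) _).trans
            (pow_le_pow_right₀ hb (by omega))
        · exact (pow_le_pow_left₀ (abs_nonneg _) (le_max_right _ _) _).trans
            (pow_le_pow_right₀ hd (by omega))
    _ = _ := by ring

end Dyson

end Model

end WeakCoupling

theorem mainTheorem3 {HS HR : Type*}
    [NormedAddCommGroup HS] [InnerProductSpace ℂ HS] [CompleteSpace HS] [FiniteDimensional ℂ HS]
    [NormedAddCommGroup HR] [InnerProductSpace ℂ HR] [CompleteSpace HR]
    [TopologicalSpace.SeparableSpace HR]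
    (M : WeakCoupling.Model HS HR) (hφ : Integrable M.correlation)
    (f : ℝ → ℝ) (C : ℝ) (hf : M.IsClusteringPair f C) :
    (∀ n : ℕ, 1 ≤ n → ∀ t : ℝ, 0 < t →
      IntegrableOn (M.dysonIntegrand n) (WeakCoupling.simplex (n + 1) t) ∧
      ‖M.K n t‖ ≤ (n + 2) * M.c f C n * t ^ (n / 2)) ∧
    ∃ C' : ℝ, C ≤ C' ∧ C' ≤ 2 * C ∧ M.IsClusteringPair f C' ∧
      (∀ n : ℕ, 1 ≤ n → ∀ t : ℝ, 0 < t → ‖M.K n t‖ ≤ M.c f C' n * t ^ (n / 2)) ∧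
      ∀ s : ℝ, Summable fun n : ℕ => M.c f C' (n + 1) * s ^ (n + 1) := by
  have hC := hf.pos
  have hC2 : C ≤ 2 * C := by linarith
  -- The choice `C' = 2 * C` multiplies `c_n` by `2 ^ (n + 2)`, which exceeds the factor `n + 2`.
  refine ⟨fun n hn t ht => ⟨M.integrableOn_dysonIntegrand n t,
    WeakCoupling.Model.norm_K_le hf hn ht⟩, 2 * C, hC2, le_rfl, hf.mono hC2,
    fun n hn t ht => ?_, fun s => M.summable_c_mul_pow f (2 * C) s⟩
  have hc : 0 ≤ M.c f C n := by
    have : 0 ≤ ∫ s, |f s| := integral_nonneg fun s => abs_nonneg _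
    unfold WeakCoupling.Model.c
    positivity
  have hn2 : (n + 2 : ℝ) ≤ 2 ^ (n + 2) := by
    exact_mod_cast (Nat.lt_two_pow_self (n := n + 2)).le
  rw [M.c_two_mul]
  refine (WeakCoupling.Model.norm_K_le hf hn ht).trans ?_
  gcongr
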